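/- **Infinite redshift of photons from the naked central singularity of a collapsing dust cloud.** *Initial data.* Let $\rho,v:\mathbb R\to\mathbb R$ be the initial density ($C^2$, even) and radial velocity ($C^3$, odd) of a spherical dust cloud as functions of the initial areal radius $R$, and for $R>0$ put $$m(R)=4\pi\int_0^R\rho(s)s^2\,ds,\quad E(R)=\tfrac12v(R)^2-\frac{m(R)}R,\quad c(R)=\frac{2m(R)}{R^3},\quad q(R)=\sqrt{-\frac{R\,E(R)}{m(R)}}.$$ Assume: $\rho\ge 0$ on $[0,\infty)$ and $\rho(0)>0$; for all $R>0$, $2m(R)/R<1$, $v(R)\le 0$, $E(R)<0$, $c'(R)\le 0$ and $q'(R)\ge0$; $\lim_{R\to0}E(R)/R^2<0$; and $\lim_{R\to 0}c'(R)/R<0$ or $\lim_{R\to0}q'(R)/R>0$. *Spacetime.* Let $r(\tau,R)$ be the areal radius of the dust shell $R$ at proper time $\tau$, i.e. the collapsing solution of $\frac12\dot r^2-m(R)/r=E(R)$ with $r(0,R)=R$, for $0\le\tau<\tau_s(R)$, where $\tau_s(R)$ is the time at which $r$ reaches $0$. On $\{R>0,\ 0<\tau<\tau_s(R)\}$ consider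 the Tolman–Bondi metric $$\mathbf g=-d\tau^2+\frac{dR^2}{\gamma^2}+r^2(d\vartheta^2+\sin^2\vartheta\,d\varphi^2),\qquad \gamma=\frac{\sqrt{1+2E(R)}}{r'(\tau,R)},$$ where dot and prime denote $\partial/\partial\tau$ and $\partial/\partial R$. The free-falling dust particles have four-velocity $\mathbf u=\partial_\tau$, and $\nu=-\mathbf g(\mathbf u,\mathbf p)$ is the frequency they measure for a photon of four-momentum $\mathbf p$. *Photons.* Consider a future directed null geodesic in the equatorial plane with affine parameter $\lambda\in(a,b)$, momenta $\pi^\tau=d\tau/d\lambda$, $\pi^R=\gamma^{-2}dR/d\lambda$ and angular momentum $\ell=r^2d\varphi/d\lambda$. Put $\chi=\sqrt{2m(R)/r}$ and $\Pi=\gamma\pi^R/\pi^\tau$ along it. Suppose that it emanates from the central singularity with $R\to0$ and $(\chi,\Pi)\to(1,1)$ as $\lambda\downarrow a$. The subscripts $e$ and $obs$ refer to the points of the geodesic at which the photon is emitted and received by dust particles. *Claim.* With $$\Lambda(y,R)=\frac{2q'(R)}{Rq(R)}h(q(R),y)-\frac{c'(R)}{2Rc(R)}g(q(R),y),\qquad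 h(q,y)=\frac1{\sqrt{1-q^2}}-\frac{y^3}{\sqrt{1-q^2y^2}}-\frac32g(q,y),$$ $$g(q,y)=\frac{f(qy)-f(q)}{q^3},\qquad f(x)=x\sqrt{1-x^2}+\arccos x$$ (the first term of $\Lambda$ being $0$ where $q=1$), the limit $A_0=\lim_{R\to0}\Lambda(0,R)/(2c(R)^{3/2})$ exists and is positive, and for every geodesic as above: 1. (Infinite redshift.) For every fixed observation point, $\nu_{obs}/\nu_e\to0$ as the emission point tends to the central singularity ($\lambda_e\downarrow a$, $R_e\to0$). 2. (Nonradial case, $\ell\ne0$.) Along the geodesic $r>0$ and $\Pi^2<1$, and for any two of its points $$\frac{\nu_{obs}}{\nu_e}=\frac{r_e}{r_{obs}}\sqrt{\frac{1-\Pi_e^2}{1-\Pi_{obs}^2}}.$$ 3. (Radial case, $\ell=0$.) Along the geodesic $R^2\,\dot\gamma/\gamma^2\to-A_0$ as $R\to0$, i.e. $\dot\gamma/\gamma^2\simeq-A_0/R^2$; and for any two of its points with $\lambda_e\le\lambda_{obs}$, if $\tau_+(R)$ denotes the proper time along the geodesic as a function of $R$, then $R\mapsto(\dot\gamma/\gamma^2)(\tau_+(R),R)$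 is integrable on $[R_e,R_{obs}]$ and $$\frac{\nu_{obs}}{\nu_e}=\exp\left[\int_{R_e}^{R_{obs}}\frac{\dot\gamma}{\gamma^2}(\tau_+(R),R)\,dR\right].$$ -/

import Mathlib

open Filter Topology Set

noncomputable section

/-- Initial data of a spherical dust cloud on the slice of proper time `0`, as functions of the
initial areal radius `R`: the mass density `ρ` and the radial velocity `v`.
Only `R > 0` is physical; on the whole real line `ρ` and `v` are the even and odd extensions. -/
structure DustData where
  ρ : ℝ → ℝ
  v : ℝ → ℝ

namespace DustData

/-- Mass function `m(R) = 4π ∫₀ᴿ ρ(s) s² ds`. -/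
def m (D : DustData) (R : ℝ) : ℝ := 4 * Real.pi * ∫ s in (0 : ℝ)..R, D.ρ s * s ^ 2

/-- Energy of the dust shell `R`: the free-fall equation at proper time `0`, where `r = R`
and `∂r/∂τ = v`. -/
def E (D : DustData) (R : ℝ) : ℝ := D.v R ^ 2 / 2 - D.m R / R

def c (D : DustData) (R : ℝ) : ℝ := 2 * D.m R / R ^ 3

def q (D : DustData) (R : ℝ) : ℝ := √(-(R * D.E R / D.m R))

/-- `f(x) = x √(1 - x²) + arccos x`. -/
def f (x : ℝ) : ℝ := x * √(1 - x ^ 2) + Real.arccos x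

def g (q y : ℝ) : ℝ := (f (q * y) - f q) / q ^ 3

def h (q y : ℝ) : ℝ :=
  1 / √(1 - q ^ 2) - y ^ 3 / √(1 - q ^ 2 * y ^ 2) - 3 / 2 * g q y

def Λ (D : DustData) (y R : ℝ) : ℝ :=
  2 * (deriv D.q R / (R * D.q R)) * h (D.q R) y
    - deriv D.c R / (2 * R * D.c R) * g (D.q R) y

/-- Proper time at which the dust shell `R` reaches the areal radius `R y²` (`0 ≤ y ≤ 1`):
the integral `∫ dr / √(2 E(R) + 2 m(R) / r)` from `r = R y²` to `r = R`. -/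
def fallTime (D : DustData) (R y : ℝ) : ℝ := g (D.q R) y / √(D.c R)

/-- Proper time at which the dust shell `R` reaches the shell-focusing singularity `r = 0`. -/
def singularTime (D : DustData) (R : ℝ) : ℝ := D.fallTime R 0

/-- Areal radius `r(τ, R)` of the dust shell `R` at proper time `τ ∈ [0, singularTime R)`:
the solution of the free-fall equation `(∂r/∂τ)² / 2 - m(R) / r = E(R)` with `r(0, R) = R`
and `∂r/∂τ < 0` for `τ > 0` (see `arealRadius_zero` and `arealRadius_freeFall`). -/
def arealRadius (D : DustData) (τ R : ℝ) : ℝ :=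
  R * (Function.invFunOn (D.fallTime R) (Ioc 0 1) τ) ^ 2

/-- The conditions on the initial data: regularity, bounded collapse, no trapped surfaces on the
initial slice, exclusion of shell crossings and nondegeneracy at the centre. -/
structure Admissible (D : DustData) : Prop where
  /-- regular initial data -/
  ρ_even : ∀ R, D.ρ (-R) = D.ρ R
  ρ_smooth : ContDiff ℝ 2 D.ρ
  v_odd : ∀ R, D.v (-R) = -D.v R
  v_smooth : ContDiff ℝ 3 D.v
  /-- nonnegative density, positive at the centre -/
  ρ_nonneg : ∀ R, 0 ≤ R → 0 ≤ D.ρ R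
  ρ_center : 0 < D.ρ 0
  /-- no trapped surface on the initial slice -/
  untrapped : ∀ R, 0 < R → 2 * D.m R / R < 1
  /-- collapse -/
  v_nonpos : ∀ R, 0 < R → D.v R ≤ 0
  /-- the shells are gravitationally bound -/
  bounded : ∀ R, 0 < R → D.E R < 0
  /-- also at the centre: the limit of `E(R) / R²` as `R → 0` is negative, i.e. `q(0) > 0` -/
  bounded_center : deriv D.v 0 ^ 2 / 2 - 4 * Real.pi / 3 * D.ρ 0 < 0
  /-- the averaged density decreases outwards -/
  c_mono : ∀ R, 0 < R → deriv D.c R ≤ 0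
  /-- together with the previous condition this excludes shell-crossing singularities -/
  q_mono : ∀ R, 0 < R → 0 ≤ deriv D.q R
  /-- nondegeneracy at the centre: `c''(0) < 0` or `q''(0) > 0` -/
  nondegenerate :
    (∃ κ > 0, ∀ᶠ R in 𝓝[>] (0 : ℝ), deriv D.c R / R ≤ -κ) ∨
    (∃ κ > 0, ∀ᶠ R in 𝓝[>] (0 : ℝ), κ ≤ deriv D.q R / R)

/-- The mass inside a shell `R > 0` is positive. -/
theorem Admissible.m_pos {D : DustData} (hD : D.Admissible) {R : ℝ} (hR : 0 < R) : 0 < D.m R := by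
  unfold m
  have hcont : Continuous (fun s => D.ρ s * s ^ 2) := hD.ρ_smooth.continuous.mul (by fun_prop)
  have hev : ∀ᶠ s in 𝓝 (0 : ℝ), 0 < D.ρ s :=
    hD.ρ_smooth.continuous.continuousAt.eventually (lt_mem_nhds hD.ρ_center)
  obtain ⟨ε, hε, hb⟩ := Metric.eventually_nhds_iff.1 hev
  have hc : 0 < min R (ε / 2) := by positivity
  have : 0 < ∫ s in (0 : ℝ)..R, D.ρ s * s ^ 2 := by
    refine intervalIntegral.integral_pos hR hcont.continuousOn
      (fun x hx => mul_nonneg (hD.ρ_nonneg x hx.1.le) (sq_nonneg x))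
      ⟨min R (ε / 2), ⟨hc.le, min_le_left _ _⟩, mul_pos (hb ?_) (by positivity)⟩
    rw [Real.dist_eq, sub_zero, abs_of_pos hc]
    exact lt_of_le_of_lt (min_le_right _ _) (by linarith)
  positivity

theorem Admissible.c_pos {D : DustData} (hD : D.Admissible) {R : ℝ} (hR : 0 < R) : 0 < D.c R := by
  have := hD.m_pos hR
  unfold c
  positivity

theorem Admissible.q_mem {D : DustData} (hD : D.Admissible) {R : ℝ} (hR : 0 < R) :
    D.q R ∈ Ioc (0 : ℝ) 1 ∧ D.q R ^ 2 = -(R * D.E R / D.m R) := by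
  have hm := hD.m_pos hR
  have hE := hD.bounded R hR
  have h1 : 0 < -(R * D.E R / D.m R) := by
    rw [← neg_div, ← mul_neg]
    have : 0 < -D.E R := by linarith
    positivity
  have h2 : -(R * D.E R / D.m R) ≤ 1 := by
    rw [← neg_div, div_le_one hm]
    unfold E
    have : R * (D.v R ^ 2 / 2 - D.m R / R) = R * D.v R ^ 2 / 2 - D.m R := by field_simp
    rw [this]
    have : 0 ≤ R * D.v R ^ 2 := by positivity
    linarith
  refine ⟨⟨Real.sqrt_pos.2 h1, Real.sqrt_le_one.2 h2⟩, Real.sq_sqrt h1.le⟩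

theorem hasStrictDerivAt_f {x : ℝ} (h : x ^ 2 < 1) :
    HasStrictDerivAt f (-2 * x ^ 2 / √(1 - x ^ 2)) x := by
  have hx : -1 < x ∧ x < 1 := abs_lt.1 ((sq_lt_one_iff_abs_lt_one x).1 h)
  have hp : 0 < 1 - x ^ 2 := by linarith
  have hs : 0 < √(1 - x ^ 2) := Real.sqrt_pos.2 hp
  have h1 : HasStrictDerivAt (fun x : ℝ => 1 - x ^ 2) (-(2 * x)) x := by
    simpa using ((hasStrictDerivAt_id x).pow 2).const_sub 1
  have h2 : HasStrictDerivAt f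
      (1 * √(1 - x ^ 2) + x * (-(2 * x) / (2 * √(1 - x ^ 2))) + -(1 / √(1 - x ^ 2))) x :=
    ((hasStrictDerivAt_id x).mul (h1.sqrt hp.ne')).add
      (Real.hasStrictDerivAt_arccos hx.1.ne' hx.2.ne)
  refine h2.congr_deriv ?_
  have h3 := Real.sq_sqrt hp.le
  field_simp
  rw [h3]; ring

theorem hasStrictDerivAt_fallTime {D : DustData} (hD : D.Admissible) {R y : ℝ} (hR : 0 < R)
    (hy : y ∈ Ioo (0 : ℝ) 1) :
    HasStrictDerivAt (D.fallTime R)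
      (-2 * y ^ 2 / √(1 - D.q R ^ 2 * y ^ 2) / √(D.c R)) y := by
  obtain ⟨⟨h0, h1⟩, -⟩ := hD.q_mem hR
  have hq : (D.q R * y) ^ 2 < 1 := by
    have : D.q R * y < 1 := by nlinarith [hy.1, hy.2]
    have : 0 < D.q R * y := mul_pos h0 hy.1
    nlinarith
  have hlin : HasStrictDerivAt (fun y : ℝ => D.q R * y) (D.q R) y := by
    simpa using (hasStrictDerivAt_id y).const_mul (D.q R)
  have h2 : HasStrictDerivAt (fun y => f (D.q R * y) - f (D.q R)) _ y :=
    ((hasStrictDerivAt_f hq).comp y hlin).sub_const (f (D.q R))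
  refine ((h2.div_const (D.q R ^ 3)).div_const (√(D.c R))).congr_deriv ?_
  congr 1
  rw [mul_pow]
  have : 0 < √(1 - D.q R ^ 2 * y ^ 2) := by
    apply Real.sqrt_pos.2
    rw [mul_pow] at hq
    linarith
  generalize √(1 - D.q R ^ 2 * y ^ 2) = A at *
  field_simp

theorem strictAntiOn_fallTime {D : DustData} (hD : D.Admissible) {R : ℝ} (hR : 0 < R) :
    StrictAntiOn (D.fallTime R) (Icc 0 1) ∧ ContinuousOn (D.fallTime R) (Icc 0 1) := by
  have hc : ContinuousOn (D.fallTime R) (Icc 0 1) := by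
    apply Continuous.continuousOn
    have := Real.continuous_arccos
    unfold fallTime g f
    fun_prop
  refine ⟨strictAntiOn_of_deriv_neg (convex_Icc 0 1) hc fun y hy => ?_, hc⟩
  rw [interior_Icc] at hy
  obtain ⟨⟨h0, h1⟩, -⟩ := hD.q_mem hR
  rw [(hasStrictDerivAt_fallTime hD hR hy).hasDerivAt.deriv]
  have hq : 0 < 1 - D.q R ^ 2 * y ^ 2 := by
    have : D.q R * y < 1 := by nlinarith [hy.1, hy.2]
    have : 0 < D.q R * y := mul_pos h0 hy.1
    nlinarith
  have := hy.1
  have := hD.c_pos hR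
  have h3 : 0 < 2 * y ^ 2 / √(1 - D.q R ^ 2 * y ^ 2) / √(D.c R) := by positivity
  have h4 : -2 * y ^ 2 / √(1 - D.q R ^ 2 * y ^ 2) / √(D.c R)
      = -(2 * y ^ 2 / √(1 - D.q R ^ 2 * y ^ 2) / √(D.c R)) := by ring
  rw [h4]; linarith

theorem fallTime_one (D : DustData) (R : ℝ) : D.fallTime R 1 = 0 := by simp [fallTime, g]

theorem arealRadius_fallTime {D : DustData} (hD : D.Admissible) {R y : ℝ} (hR : 0 < R)
    (hy : y ∈ Ioc (0 : ℝ) 1) : D.arealRadius (D.fallTime R y) R = R * y ^ 2 := by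
  have hinj := ((strictAntiOn_fallTime hD hR).1.injOn).mono Ioc_subset_Icc_self
  have hmem : ∃ z ∈ Ioc (0 : ℝ) 1, D.fallTime R z = D.fallTime R y := ⟨y, hy, rfl⟩
  unfold arealRadius
  rw [hinj (Function.invFunOn_mem hmem) hy (Function.invFunOn_eq hmem)]

theorem arealRadius_zero {D : DustData} (hD : D.Admissible) {R : ℝ} (hR : 0 < R) :
    D.arealRadius 0 R = R := by
  have := arealRadius_fallTime hD hR (y := 1) ⟨one_pos, le_rfl⟩
  simpa [fallTime_one] using this

/-- `arealRadius` solves the free-fall equation and the shell is collapsing. -/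
theorem arealRadius_freeFall {D : DustData} (hD : D.Admissible) {τ R : ℝ} (hR : 0 < R)
    (hτ : 0 < τ) (hτ' : τ < D.singularTime R) :
    0 < D.arealRadius τ R ∧ ∃ w < 0, HasDerivAt (fun t => D.arealRadius t R) w τ ∧
      w ^ 2 / 2 - D.m R / D.arealRadius τ R = D.E R := by
  obtain ⟨hanti, hcont⟩ := strictAntiOn_fallTime hD hR
  obtain ⟨y, hy, rfl⟩ : τ ∈ D.fallTime R '' Ioo 0 1 :=
    intermediate_value_Ioo' zero_le_one hcont ⟨by rwa [fallTime_one], hτ'⟩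
  obtain ⟨⟨h0, h1⟩, hqsq⟩ := hD.q_mem hR
  have hm := hD.m_pos hR
  have hc := hD.c_pos hR
  have hyp := hy.1
  have hq : 0 < 1 - D.q R ^ 2 * y ^ 2 := by
    have : D.q R * y < 1 := by nlinarith [hy.1, hy.2]
    have : 0 < D.q R * y := mul_pos h0 hy.1
    nlinarith
  set A := √(1 - D.q R ^ 2 * y ^ 2) with hA
  set C := √(D.c R) with hC
  have hAp : 0 < A := Real.sqrt_pos.2 hq
  have hCp : 0 < C := Real.sqrt_pos.2 hc
  have hd := hasStrictDerivAt_fallTime hD hR hy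
  have hne : -2 * y ^ 2 / A / C ≠ 0 := by
    have : 0 < 2 * y ^ 2 / A / C := by positivity
    have h4 : -2 * y ^ 2 / A / C = -(2 * y ^ 2 / A / C) := by ring
    rw [h4]; linarith
  have hli := hd.to_localInverse hne
  set G := hd.localInverse (D.fallTime R) _ y hne with hG
  have hGy : G (D.fallTime R y) = y := HasStrictFDerivAt.localInverse_apply_image _
  have hri : ∀ᶠ t in 𝓝 (D.fallTime R y), D.fallTime R (G t) = t :=
    HasStrictFDerivAt.eventually_right_inverse _
  have hmem : ∀ᶠ t in 𝓝 (D.fallTime R y), G t ∈ Ioo (0 : ℝ) 1 := by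
    apply hli.hasDerivAt.continuousAt.eventually
    rw [hGy]
    exact Ioo_mem_nhds hy.1 hy.2
  have heq : (fun t => D.arealRadius t R) =ᶠ[𝓝 (D.fallTime R y)] fun t => R * G t ^ 2 := by
    filter_upwards [hri, hmem] with t ht htm
    conv_lhs => rw [← ht]
    exact arealRadius_fallTime hD hR ⟨htm.1, htm.2.le⟩
  have hder := ((hli.hasDerivAt.pow 2).const_mul R).congr_of_eventuallyEq heq
  rw [arealRadius_fallTime hD hR ⟨hy.1, hy.2.le⟩]
  refine ⟨by positivity, -(R * A * C / y), ?_, hder.congr_deriv ?_, ?_⟩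
  · have : 0 < R * A * C / y := by positivity
    linarith
  · rw [hGy]
    change R * (↑2 * y ^ (2 - 1) * (-2 * y ^ 2 / A / C)⁻¹) = -(R * A * C / y)
    clear hder heq hmem hri hGy hli hG G hne hd
    clear_value A C
    field_simp
    norm_num
  · have hA2 : A ^ 2 = 1 - D.q R ^ 2 * y ^ 2 := Real.sq_sqrt hq.le
    have hC2 : C ^ 2 = 2 * D.m R / R ^ 3 := Real.sq_sqrt hc.le
    have : (-(R * A * C / y)) ^ 2 = R ^ 2 * A ^ 2 * C ^ 2 / y ^ 2 := by ring
    rw [this, hA2, hC2, hqsq]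
    field_simp
    ring

/-- `γ = √(1 + 2E) / r'`, where the prime is `∂/∂R`. -/
def γ (D : DustData) (τ R : ℝ) : ℝ :=
  √(1 + 2 * D.E R) / deriv (fun x => D.arealRadius τ x) R

/-- `Ψ` with `exp Ψ = 1 / γ`. -/
def Ψ (D : DustData) (τ R : ℝ) : ℝ := -Real.log (D.γ τ R)

/-- The Tolman–Bondi metric in the comoving coordinates `x = (τ, R, ϑ, φ)`:
`-dτ² + dR² / γ² + r² (dϑ² + sin² ϑ dφ²)`. -/
def metric (D : DustData) (x X Y : Fin 4 → ℝ) : ℝ :=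
  -(X 0 * Y 0) + X 1 * Y 1 / D.γ (x 0) (x 1) ^ 2
    + D.arealRadius (x 0) (x 1) ^ 2 * (X 2 * Y 2 + Real.sin (x 2) ^ 2 * (X 3 * Y 3))

/-- `χ = √(2 m(R) / r)`. -/
def χ (D : DustData) (τ R : ℝ) : ℝ := √(2 * D.m R / D.arealRadius τ R)

/-- The ratio `γ̇ / γ²`, where the dot is `∂/∂τ`. -/
def γdotRatio (D : DustData) (τ R : ℝ) : ℝ := deriv (fun t => D.γ t R) τ / D.γ τ R ^ 2

end DustData

/-- A future directed null geodesic of the Tolman–Bondi spacetime in the equatorial plane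
`ϑ = π/2`, with affine parameter `s ∈ (a, b)`, coordinates `(τ, R, φ)`, momenta
`πτ = dτ/ds`, `πR = exp(2Ψ) dR/ds`, and conserved angular momentum `ℓ = r² dφ/ds`. -/
structure NullGeodesic (D : DustData) where
  a : ℝ
  b : ℝ
  hab : a < b
  τ : ℝ → ℝ
  R : ℝ → ℝ
  φ : ℝ → ℝ
  πτ : ℝ → ℝ
  πR : ℝ → ℝ
  ℓ : ℝ
  /-- the curve lies in the spacetime, i.e. to the past of the singularity -/
  R_pos : ∀ s ∈ Ioo a b, 0 < R s
  τ_pos : ∀ s ∈ Ioo a b, 0 < τ s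
  τ_lt : ∀ s ∈ Ioo a b, τ s < D.singularTime (R s)
  /-- the Euler–Lagrange equations of
  `(-(dτ/ds)² + exp(2Ψ) (dR/ds)² + r² (dφ/ds)²) / 2` in first-order form -/
  τ_eq : ∀ s ∈ Ioo a b, HasDerivAt τ (πτ s) s
  πτ_eq : ∀ s ∈ Ioo a b, HasDerivAt πτ
    (-(deriv (fun t => D.Ψ t (R s)) (τ s)) * Real.exp (-2 * D.Ψ (τ s) (R s)) * πR s ^ 2
      - ℓ ^ 2 / D.arealRadius (τ s) (R s) ^ 3
        * deriv (fun t => D.arealRadius t (R s)) (τ s)) s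
  R_eq : ∀ s ∈ Ioo a b, HasDerivAt R (Real.exp (-2 * D.Ψ (τ s) (R s)) * πR s) s
  πR_eq : ∀ s ∈ Ioo a b, HasDerivAt πR
    (deriv (fun x => D.Ψ (τ s) x) (R s) * Real.exp (-2 * D.Ψ (τ s) (R s)) * πR s ^ 2
      + ℓ ^ 2 / D.arealRadius (τ s) (R s) ^ 3
        * deriv (fun x => D.arealRadius (τ s) x) (R s)) s
  φ_eq : ∀ s ∈ Ioo a b, HasDerivAt φ (ℓ / D.arealRadius (τ s) (R s) ^ 2) s
  /-- future directed -/
  πτ_pos : ∀ s ∈ Ioo a b, 0 < πτ s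
  /-- the nullity constraint -/
  null : ∀ s ∈ Ioo a b,
    D.metric ![τ s, R s, Real.pi / 2, φ s]
      ![πτ s, Real.exp (-2 * D.Ψ (τ s) (R s)) * πR s, 0, ℓ / D.arealRadius (τ s) (R s) ^ 2]
      ![πτ s, Real.exp (-2 * D.Ψ (τ s) (R s)) * πR s, 0, ℓ / D.arealRadius (τ s) (R s) ^ 2] = 0

namespace NullGeodesic

variable {D : DustData}

/-- The position in the coordinates `(τ, R, ϑ, φ)`. -/
def pos (Γ : NullGeodesic D) (s : ℝ) : Fin 4 → ℝ := ![Γ.τ s, Γ.R s, Real.pi / 2, Γ.φ s]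

/-- Areal radius along the ray. -/
def r (Γ : NullGeodesic D) (s : ℝ) : ℝ := D.arealRadius (Γ.τ s) (Γ.R s)

/-- The four-momentum `p`. -/
def p (Γ : NullGeodesic D) (s : ℝ) : Fin 4 → ℝ :=
  ![Γ.πτ s, Real.exp (-2 * D.Ψ (Γ.τ s) (Γ.R s)) * Γ.πR s, 0, Γ.ℓ / Γ.r s ^ 2]

/-- The frequency `ν = -g(u, p)` measured by the free-falling dust particle that the ray meets
at parameter `s`; its four-velocity is `u = ∂/∂τ`. -/
def ν (Γ : NullGeodesic D) (s : ℝ) : ℝ := -D.metric (Γ.pos s) ![1, 0, 0, 0] (Γ.p s)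

/-- `χ` along the ray. -/
def χ (Γ : NullGeodesic D) (s : ℝ) : ℝ := D.χ (Γ.τ s) (Γ.R s)

/-- `Π = γ πR / πτ` along the ray. -/
def Pi (Γ : NullGeodesic D) (s : ℝ) : ℝ := D.γ (Γ.τ s) (Γ.R s) * Γ.πR s / Γ.πτ s

/-- The ray emanates from the central singularity with `(χ, Π) → (1, 1)`. -/
structure EmanatesAtOneOne (Γ : NullGeodesic D) : Prop where
  R_tendsto : Tendsto Γ.R (𝓝[>] Γ.a) (𝓝 0)
  χ_tendsto : Tendsto Γ.χ (𝓝[>] Γ.a) (𝓝 1)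
  Pi_tendsto : Tendsto Γ.Pi (𝓝[>] Γ.a) (𝓝 1)

end NullGeodesic

end

/-! The dust moves along ∂_τ, so ν = π^τ, and the nullity constraint divided by (π^τ)² reads 1 − Π²
= (ℓ/(rν))² (`one_sub_Pi_sq`). For ℓ ≠ 0 the redshift formula is therefore algebra, and ν_obs/ν_e →
0 because r_e → 0 while Π_e converges.

For ℓ = 0 the constraint and Π → 1 force γπ^R = π^τ, and the geodesic equation becomes d log ν =
(γ̇/γ²) dR (`hasDerivAt_log_πτ`); a change of variables gives the integral formula. The redshift is
infinite because γ̇/γ² ≃ −A₀/R² is not integrable at R = 0. To see this, write r = R y².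
Differentiating the fall time implicitly gives r' = y² + R²Λ√(1 − q²y²)/y, and γ̇/γ² = −∂_τ r'/√(1 +
2E). The condition χ → 1 means y ≃ √c R, and then the term −Λ R²/y² dominates ∂_y r'
(`tendsto_ratioFormula`).

It remains to see that Λ has a positive limit at the centre (`exists_tendsto_Λ`). The factor 1/√(1 −
q²) in Λ is singular where q = 1. The remedy is `p` = −v/(R√c) = √(1 − q²), which is differentiable
for R > 0: from q q' = −p p' follows q'/√(1 − q²) = −p'/q. Parity of ρ and v gives limits of c'/R,
p'/R and q'/R; the signs of c' and q' make the limit of Λ nonnegative, and nondegeneracy makes it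
positive. -/

noncomputable section

namespace DustData

variable {D : DustData}

/-! ### Derivatives of the initial data, with `p` in place of √(1 − q²) -/

theorem Admissible.hasDerivAt_m (hD : D.Admissible) (R : ℝ) :
    HasDerivAt D.m (4 * Real.pi * (D.ρ R * R ^ 2)) R := by
  have hcont : Continuous (fun s => D.ρ s * s ^ 2) := hD.ρ_smooth.continuous.mul (by fun_prop)
  exact (hcont.integral_hasStrictDerivAt 0 R).hasDerivAt.const_mul _

/-- The derivative of `c` at `R > 0`. -/
def c' (D : DustData) (R : ℝ) : ℝ := (8 * Real.pi * D.ρ R - 3 * D.c R) / R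

/-- The velocity gradient `v(R) / R`. -/
def w (D : DustData) (R : ℝ) : ℝ := D.v R / R

/-- The derivative of `w` at `R ≠ 0`. -/
def w' (D : DustData) (R : ℝ) : ℝ := (deriv D.v R * R - D.v R) / R ^ 2

/-- `p = -v / (R √c)`, which equals `√(1 - q²)`. -/
def p (D : DustData) (R : ℝ) : ℝ := -(D.w R / √(D.c R))

/-- The derivative of `p` at `R > 0`. -/
def p' (D : DustData) (R : ℝ) : ℝ :=
  -(D.w' R / √(D.c R)) + D.w R * D.c' R / (2 * D.c R * √(D.c R))

/-- The derivative of `q` at `R > 0`. -/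
def q' (D : DustData) (R : ℝ) : ℝ := -(D.p R * D.p' R / D.q R)

theorem Admissible.hasDerivAt_c (hD : D.Admissible) {R : ℝ} (hR : 0 < R) :
    HasDerivAt D.c (D.c' R) R := by
  have h := ((hD.hasDerivAt_m R).const_mul 2).div (hasDerivAt_pow 3 R) (by positivity)
  refine h.congr_deriv ?_
  unfold c' c
  push_cast
  field_simp
  ring

theorem Admissible.differentiable_v (hD : D.Admissible) : Differentiable ℝ D.v :=
  hD.v_smooth.differentiable (by norm_num)

theorem Admissible.contDiff_deriv_v (hD : D.Admissible) : ContDiff ℝ 2 (deriv D.v) :=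
  ((contDiff_succ_iff_deriv (n := 2)).1 hD.v_smooth).2.2

theorem Admissible.hasDerivAt_w (hD : D.Admissible) {R : ℝ} (hR : 0 < R) :
    HasDerivAt D.w (D.w' R) R := by
  have h := (hD.differentiable_v R).hasDerivAt.div (hasDerivAt_id R) hR.ne'
  refine h.congr_deriv ?_
  simp [w']

theorem Admissible.hasDerivAt_p (hD : D.Admissible) {R : ℝ} (hR : 0 < R) :
    HasDerivAt D.p (D.p' R) R := by
  have hc := hD.c_pos hR
  have hs : 0 < √(D.c R) := Real.sqrt_pos.2 hc
  have h := ((hD.hasDerivAt_w hR).div ((hD.hasDerivAt_c hR).sqrt hc.ne') hs.ne').neg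
  refine h.congr_deriv ?_
  unfold p'
  have h2 := Real.sq_sqrt hc.le
  generalize √(D.c R) = A at *
  rw [← h2]
  field_simp
  ring

theorem Admissible.p_nonneg (hD : D.Admissible) {R : ℝ} (hR : 0 < R) : 0 ≤ D.p R := by
  unfold p w
  have := hD.v_nonpos R hR
  rw [← neg_div, ← neg_div]
  have h : 0 ≤ -D.v R := by linarith
  positivity

theorem Admissible.q_sq (hD : D.Admissible) {R : ℝ} (hR : 0 < R) : D.q R ^ 2 = 1 - D.p R ^ 2 := by
  rw [(hD.q_mem hR).2]
  have hm := hD.m_pos hR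
  unfold p w E
  rw [neg_sq, div_pow, Real.sq_sqrt (hD.c_pos hR).le]
  unfold c
  field_simp
  ring

theorem Admissible.sqrt_one_sub_q_sq (hD : D.Admissible) {R : ℝ} (hR : 0 < R) :
    √(1 - D.q R ^ 2) = D.p R := by
  rw [hD.q_sq hR, sub_sub_cancel, Real.sqrt_sq (hD.p_nonneg hR)]

theorem Admissible.q_eq_sqrt (hD : D.Admissible) {R : ℝ} (hR : 0 < R) :
    D.q R = √(1 - D.p R ^ 2) := by
  rw [← hD.q_sq hR, Real.sqrt_sq (hD.q_mem hR).1.1.le]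

theorem Admissible.p_lt_one (hD : D.Admissible) {R : ℝ} (hR : 0 < R) : D.p R < 1 := by
  have h1 := hD.q_sq hR
  have h2 := (hD.q_mem hR).1.1
  have h3 := hD.p_nonneg hR
  nlinarith [pow_pos h2 2]

theorem Admissible.hasDerivAt_q (hD : D.Admissible) {R : ℝ} (hR : 0 < R) :
    HasDerivAt D.q (D.q' R) R := by
  have hq := (hD.q_mem hR).1.1
  have hpos : 0 < 1 - D.p R ^ 2 := by rw [← hD.q_sq hR]; positivity
  have h := (((hD.hasDerivAt_p hR).pow 2).const_sub 1).sqrt hpos.ne'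
  have heq : D.q =ᶠ[𝓝 R] fun x => √(1 - D.p x ^ 2) := by
    filter_upwards [lt_mem_nhds hR] with x hx using hD.q_eq_sqrt hx
  refine (h.congr_of_eventuallyEq heq).congr_deriv ?_
  simp only [Pi.pow_apply]
  rw [← hD.q_eq_sqrt hR]
  unfold q'
  push_cast
  field_simp

/-- `f` expressed through `p = √(1 - x²)`. -/
theorem f_eq_arcsin {x : ℝ} (hx : 0 ≤ x) : f x = x * √(1 - x ^ 2) + Real.arcsin (√(1 - x ^ 2)) := by
  rw [f, Real.arccos_eq_arcsin hx]

theorem Admissible.f_q_eq (hD : D.Admissible) {R : ℝ} (hR : 0 < R) :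
    f (D.q R) = D.q R * D.p R + Real.arcsin (D.p R) := by
  rw [f_eq_arcsin (hD.q_mem hR).1.1.le, hD.sqrt_one_sub_q_sq hR]

/-- The chain rule through `f` fails at q = 1, where arccos is not differentiable. Writing f(q) = q
p + arcsin p avoids this, since p < 1; the factor 1/p from f' cancels against q' = −p p'/q. -/
theorem Admissible.hasDerivAt_f_q (hD : D.Admissible) {R : ℝ} (hR : 0 < R) :
    HasDerivAt (fun x => f (D.q x)) (2 * D.q R * D.p' R) R := by
  have hq := (hD.q_mem hR).1.1
  have hp := hD.p_lt_one hR
  have hp0 := hD.p_nonneg hR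
  have h := ((hD.hasDerivAt_q hR).mul (hD.hasDerivAt_p hR)).add
    ((Real.hasDerivAt_arcsin (by linarith) hp.ne).comp R (hD.hasDerivAt_p hR))
  have heq : (fun x => f (D.q x)) =ᶠ[𝓝 R] fun x => D.q x * D.p x + Real.arcsin (D.p x) := by
    filter_upwards [lt_mem_nhds hR] with x hx using hD.f_q_eq hx
  refine (h.congr_of_eventuallyEq heq).congr_deriv ?_
  rw [← hD.q_eq_sqrt hR]
  have := hD.q_sq hR
  unfold q'
  field_simp
  linear_combination (-D.p' R) * this

/-- Where `q = 1`, also `p' = 0`, since `p` has a minimum there. -/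
theorem Admissible.p'_eq_zero (hD : D.Admissible) {R : ℝ} (hR : 0 < R) (h : D.p R = 0) :
    D.p' R = 0 := by
  refine IsLocalMin.hasDerivAt_eq_zero ?_ (hD.hasDerivAt_p hR)
  filter_upwards [lt_mem_nhds hR] with x hx
  rw [h]
  exact hD.p_nonneg hx

theorem Admissible.q'_nonneg (hD : D.Admissible) {R : ℝ} (hR : 0 < R) : 0 ≤ D.q' R := by
  rw [← (hD.hasDerivAt_q hR).deriv]
  exact hD.q_mono R hR

theorem Admissible.c'_nonpos (hD : D.Admissible) {R : ℝ} (hR : 0 < R) : D.c' R ≤ 0 := by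
  rw [← (hD.hasDerivAt_c hR).deriv]
  exact hD.c_mono R hR

/-- Holds also at p = 0: there 1/p is read as 0 and p' vanishes, which agrees with the convention
that the first term of Λ is 0 where q = 1. -/
theorem Admissible.q'_div_p (hD : D.Admissible) {R : ℝ} (hR : 0 < R) :
    D.q' R * (1 / D.p R) = -(D.p' R / D.q R) := by
  have hq := (hD.q_mem hR).1.1
  by_cases h : D.p R = 0
  · simp [q', h, hD.p'_eq_zero hR h]
  · unfold q'
    field_simp

/-- The singularity-free form of `Λ`. -/
theorem Admissible.Λ_eq (hD : D.Admissible) {R : ℝ} (hR : 0 < R) (y : ℝ) :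
    D.Λ y R = 2 / D.q R * (-(D.p' R / R / D.q R) - D.q' R / R *
      (y ^ 3 / √(1 - D.q R ^ 2 * y ^ 2) + 3 / 2 * g (D.q R) y))
      - D.c' R / R / (2 * D.c R) * g (D.q R) y := by
  have hq := (hD.q_mem hR).1.1
  have hc := hD.c_pos hR
  have h := hD.q'_div_p hR
  unfold Λ DustData.h
  rw [(hD.hasDerivAt_q hR).deriv, (hD.hasDerivAt_c hR).deriv, hD.sqrt_one_sub_q_sq hR]
  have h2 : D.p' R / R / D.q R = -(D.q' R * (1 / D.p R)) / R := by rw [h]; ring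
  rw [h2]
  generalize 1 / D.p R = A
  generalize y ^ 3 / √(1 - D.q R ^ 2 * y ^ 2) = B
  field_simp
  ring

/-! ### Continuity at positive radius -/

theorem Admissible.continuousAt_c' (hD : D.Admissible) {R : ℝ} (hR : 0 < R) :
    ContinuousAt D.c' R := by
  have h1 := (hD.hasDerivAt_c hR).continuousAt
  have h2 := hD.ρ_smooth.continuous.continuousAt (x := R)
  unfold c'
  exact ((h2.const_mul _).sub (h1.const_mul _)).div continuousAt_id hR.ne'

theorem Admissible.continuousAt_p' (hD : D.Admissible) {R : ℝ} (hR : 0 < R) :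
    ContinuousAt D.p' R := by
  have hc := hD.c_pos hR
  have hs : 0 < √(D.c R) := Real.sqrt_pos.2 hc
  have h1 := (hD.hasDerivAt_c hR).continuousAt
  have h2 := (hD.hasDerivAt_w hR).continuousAt
  have h3 := hD.continuousAt_c' hR
  have h4 : ContinuousAt D.w' R := by
    unfold w'
    have := hD.contDiff_deriv_v.continuous
    have := hD.v_smooth.continuous
    exact ContinuousAt.div (by fun_prop) (by fun_prop) (by positivity)
  unfold p'
  exact ((h4.div h1.sqrt hs.ne').neg).add
    ((h2.mul h3).div ((h1.const_mul 2).mul h1.sqrt) (by positivity))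

theorem Admissible.continuousAt_q' (hD : D.Admissible) {R : ℝ} (hR : 0 < R) :
    ContinuousAt D.q' R := by
  have hq := (hD.q_mem hR).1.1
  unfold q'
  exact (((hD.hasDerivAt_p hR).continuousAt.mul (hD.continuousAt_p' hR)).div
    (hD.hasDerivAt_q hR).continuousAt hq.ne').neg

theorem continuous_f : Continuous f := by
  have := Real.continuous_arccos
  unfold f
  fun_prop

/-! ### Limits at the centre -/

/-- The central value of `c`. -/
def c₀ (D : DustData) : ℝ := 8 * Real.pi / 3 * D.ρ 0

theorem Admissible.c₀_pos (hD : D.Admissible) : 0 < D.c₀ := by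
  have := hD.ρ_center
  have := Real.pi_pos
  unfold c₀
  positivity

/-- The central value of `p`. -/
def p₀ (D : DustData) : ℝ := -(deriv D.v 0 / √D.c₀)

/-- The central value of `q`. -/
def q₀ (D : DustData) : ℝ := √(1 - D.p₀ ^ 2)

theorem Admissible.q₀_pos (hD : D.Admissible) : 0 < D.q₀ := by
  have h := hD.bounded_center
  have hc := hD.c₀_pos
  refine Real.sqrt_pos.2 ?_
  unfold p₀
  rw [neg_sq, div_pow, Real.sq_sqrt hc.le, sub_pos, div_lt_one hc]
  unfold c₀
  linarith

theorem m_zero (D : DustData) : D.m 0 = 0 := by simp [m]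

theorem Admissible.tendsto_c (hD : D.Admissible) : Tendsto D.c (𝓝[>] 0) (𝓝 D.c₀) := by
  have hm := (hD.hasDerivAt_m 0).continuousAt.tendsto
  refine HasDerivAt.lhopital_zero_nhdsGT (f' := fun R => 2 * (4 * Real.pi * (D.ρ R * R ^ 2)))
    (g' := fun R => 3 * R ^ 2) (.of_forall fun R => (hD.hasDerivAt_m R).const_mul 2)
    (.of_forall fun R => by simpa using hasDerivAt_pow 3 R) ?_ ?_ ?_ ?_
  · filter_upwards [self_mem_nhdsWithin] with R (hR : 0 < R)
    positivity
  · have := (hm.const_mul 2).mono_left (nhdsWithin_le_nhds (s := Ioi 0))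
    simpa [m_zero] using this
  · have : Tendsto (fun R : ℝ => R ^ 3) (𝓝 0) (𝓝 (0 ^ 3)) := (continuous_pow 3).tendsto 0
    simpa using this.mono_left (nhdsWithin_le_nhds (s := Ioi 0))
  · have h1 : Tendsto (fun R => 8 * Real.pi / 3 * D.ρ R) (𝓝[>] 0) (𝓝 D.c₀) :=
      ((hD.ρ_smooth.continuous.tendsto 0).const_mul _).mono_left nhdsWithin_le_nhds
    refine h1.congr' ?_
    filter_upwards [self_mem_nhdsWithin] with R (hR : 0 < R)
    field_simp
    ring

theorem tendsto_div_of_hasDerivAt_zero {F : ℝ → ℝ} {d : ℝ} (h : HasDerivAt F d 0) (h0 : F 0 = 0) :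
    Tendsto (fun R => F R / R) (𝓝[>] 0) (𝓝 d) := by
  have := h.tendsto_slope.mono_left (nhdsWithin_mono 0 (fun x (hx : 0 < x) => hx.ne'))
  refine this.congr fun x => ?_
  rw [slope_def_field]
  simp [h0]

theorem deriv_zero_of_even {F : ℝ → ℝ} (h : ∀ x, F (-x) = F x) : deriv F 0 = 0 := by
  have h1 := deriv_comp_neg F 0
  have h2 : (fun x => F (-x)) = F := funext h
  rw [h2, neg_zero] at h1
  linarith

theorem Admissible.tendsto_w (hD : D.Admissible) : Tendsto D.w (𝓝[>] 0) (𝓝 (deriv D.v 0)) := by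
  refine tendsto_div_of_hasDerivAt_zero (hD.differentiable_v 0).hasDerivAt ?_
  have := hD.v_odd 0
  rw [neg_zero] at this
  linarith

theorem Admissible.tendsto_p (hD : D.Admissible) : Tendsto D.p (𝓝[>] 0) (𝓝 D.p₀) :=
  (hD.tendsto_w.div hD.tendsto_c.sqrt (Real.sqrt_pos.2 hD.c₀_pos).ne').neg

theorem Admissible.tendsto_q (hD : D.Admissible) : Tendsto D.q (𝓝[>] 0) (𝓝 D.q₀) := by
  have h : Tendsto (fun R => √(1 - D.p R ^ 2)) (𝓝[>] 0) (𝓝 D.q₀) :=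
    ((hD.tendsto_p.pow 2).const_sub 1).sqrt
  refine h.congr' ?_
  filter_upwards [self_mem_nhdsWithin] with R hR using (hD.q_eq_sqrt hR).symm

/-- Here c'/R = (8πρR³ − 6m)/R⁵. Differentiating the numerator, the terms in ρ cancel and 8πρ'R³
remains, so l'Hôpital leads to 8πρ'/(5R), which converges because ρ is even and ρ'(0) = 0. -/
theorem Admissible.tendsto_c'_div (hD : D.Admissible) :
    ∃ l, Tendsto (fun R => D.c' R / R) (𝓝[>] 0) (𝓝 l) := by
  have hρ1 : ContDiff ℝ 1 (deriv D.ρ) :=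
    ((contDiff_succ_iff_deriv (n := 1)).1 hD.ρ_smooth).2.2
  have hρd : Differentiable ℝ D.ρ := hD.ρ_smooth.differentiable (by norm_num)
  have hlim : Tendsto (fun R => 8 * Real.pi / 5 * (deriv D.ρ R / R)) (𝓝[>] 0)
      (𝓝 (8 * Real.pi / 5 * deriv (deriv D.ρ) 0)) :=
    (tendsto_div_of_hasDerivAt_zero (hρ1.differentiable (by norm_num) 0).hasDerivAt
      (deriv_zero_of_even hD.ρ_even)).const_mul _
  refine ⟨8 * Real.pi / 5 * deriv (deriv D.ρ) 0, ?_⟩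
  have key : Tendsto (fun R => (8 * Real.pi * (D.ρ R * R ^ 3) - 6 * D.m R) / R ^ 5) (𝓝[>] 0)
      (𝓝 (8 * Real.pi / 5 * deriv (deriv D.ρ) 0)) := by
    refine HasDerivAt.lhopital_zero_nhdsGT
      (f' := fun R => 8 * Real.pi * (deriv D.ρ R * R ^ 3 + D.ρ R * (3 * R ^ 2))
        - 6 * (4 * Real.pi * (D.ρ R * R ^ 2)))
      (g' := fun R => 5 * R ^ 4) (.of_forall fun R => ?_)
      (.of_forall fun R => by simpa using hasDerivAt_pow 5 R) ?_ ?_ ?_ ?_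
    · have h3 : HasDerivAt (fun R : ℝ => R ^ 3) (3 * R ^ 2) R := by simpa using hasDerivAt_pow 3 R
      exact (((hρd R).hasDerivAt.mul h3).const_mul _).sub ((hD.hasDerivAt_m R).const_mul 6)
    · filter_upwards [self_mem_nhdsWithin] with R (hR : 0 < R)
      positivity
    · have hm : ContinuousAt D.m 0 := (hD.hasDerivAt_m 0).continuousAt
      have hρ := hD.ρ_smooth.continuous
      have : ContinuousAt (fun R => 8 * Real.pi * (D.ρ R * R ^ 3) - 6 * D.m R) 0 := by fun_prop
      simpa [m_zero] using this.tendsto.mono_left (nhdsWithin_le_nhds (s := Ioi 0))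
    · have : Tendsto (fun R : ℝ => R ^ 5) (𝓝 0) (𝓝 (0 ^ 5)) := (continuous_pow 5).tendsto 0
      simpa using this.mono_left (nhdsWithin_le_nhds (s := Ioi 0))
    · refine hlim.congr' ?_
      filter_upwards [self_mem_nhdsWithin] with R (hR : 0 < R)
      field_simp
      ring
  refine key.congr' ?_
  filter_upwards [self_mem_nhdsWithin] with R (hR : 0 < R)
  unfold c' c
  field_simp
  ring

/-- The same argument one order higher: l'Hôpital turns (v'R − v)/R³ into v''/(3R), and v''(0) = 0
because v' is even. -/
theorem Admissible.tendsto_w'_div (hD : D.Admissible) :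
    ∃ l, Tendsto (fun R => D.w' R / R) (𝓝[>] 0) (𝓝 l) := by
  have hv1 := hD.contDiff_deriv_v
  have hv2 : ContDiff ℝ 1 (deriv (deriv D.v)) :=
    ((contDiff_succ_iff_deriv (n := 1)).1 hv1).2.2
  have heven : ∀ x, deriv D.v (-x) = deriv D.v x := by
    intro x
    have h1 := deriv_comp_neg D.v x
    have h2 : (fun x => D.v (-x)) = fun x => -D.v x := funext hD.v_odd
    rw [h2, deriv.fun_neg] at h1
    linarith
  have hv0 : D.v 0 = 0 := by
    have := hD.v_odd 0
    rw [neg_zero] at this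
    linarith
  have hd1 : Differentiable ℝ (deriv D.v) := hv1.differentiable (by norm_num)
  have hlim : Tendsto (fun R => 1 / 3 * (deriv (deriv D.v) R / R)) (𝓝[>] 0)
      (𝓝 (1 / 3 * deriv (deriv (deriv D.v)) 0)) :=
    (tendsto_div_of_hasDerivAt_zero (hv2.differentiable (by norm_num) 0).hasDerivAt
      (deriv_zero_of_even heven)).const_mul _
  refine ⟨1 / 3 * deriv (deriv (deriv D.v)) 0, ?_⟩
  have key : Tendsto (fun R => (deriv D.v R * R - D.v R) / R ^ 3) (𝓝[>] 0)
      (𝓝 (1 / 3 * deriv (deriv (deriv D.v)) 0)) := by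
    refine HasDerivAt.lhopital_zero_nhdsGT
      (f' := fun R => deriv (deriv D.v) R * R + deriv D.v R * 1 - deriv D.v R)
      (g' := fun R => 3 * R ^ 2) (.of_forall fun R => ?_)
      (.of_forall fun R => by simpa using hasDerivAt_pow 3 R) ?_ ?_ ?_ ?_
    · exact ((hd1 R).hasDerivAt.mul (hasDerivAt_id R)).sub (hD.differentiable_v R).hasDerivAt
    · filter_upwards [self_mem_nhdsWithin] with R (hR : 0 < R)
      positivity
    · have := hv1.continuous
      have := hD.v_smooth.continuous
      have : ContinuousAt (fun R => deriv D.v R * R - D.v R) 0 := by fun_prop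
      simpa [hv0] using this.tendsto.mono_left (nhdsWithin_le_nhds (s := Ioi 0))
    · have : Tendsto (fun R : ℝ => R ^ 3) (𝓝 0) (𝓝 (0 ^ 3)) := (continuous_pow 3).tendsto 0
      simpa using this.mono_left (nhdsWithin_le_nhds (s := Ioi 0))
    · refine hlim.congr' ?_
      filter_upwards [self_mem_nhdsWithin] with R (hR : 0 < R)
      field_simp
      ring
  refine key.congr' ?_
  filter_upwards [self_mem_nhdsWithin] with R (hR : 0 < R)
  unfold w'
  field_simp

theorem Admissible.tendsto_p'_div (hD : D.Admissible) :
    ∃ l, Tendsto (fun R => D.p' R / R) (𝓝[>] 0) (𝓝 l) := by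
  obtain ⟨a, ha⟩ := hD.tendsto_w'_div
  obtain ⟨b, hb⟩ := hD.tendsto_c'_div
  have hc := hD.c₀_pos
  have hs : 0 < √D.c₀ := Real.sqrt_pos.2 hc
  have ht := hD.tendsto_c
  have h := ((ha.div ht.sqrt hs.ne').neg).add
    ((hD.tendsto_w.mul hb).div ((ht.const_mul 2).mul ht.sqrt) (by positivity))
  refine ⟨_, h.congr fun R => ?_⟩
  simp only [Pi.div_apply]
  unfold p'
  ring

theorem Admissible.tendsto_q'_div (hD : D.Admissible) {P : ℝ}
    (hP : Tendsto (fun R => D.p' R / R) (𝓝[>] 0) (𝓝 P)) :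
    Tendsto (fun R => D.q' R / R) (𝓝[>] 0) (𝓝 (-(D.p₀ * P / D.q₀))) := by
  refine ((hD.tendsto_p.mul hP).div hD.tendsto_q hD.q₀_pos.ne').neg.congr fun R => ?_
  simp only [Pi.div_apply]
  unfold q'
  ring

/-! ### The functions `g`, `h` and `Λ` -/

theorem one_sub_sq_mul_sq_pos {q y : ℝ} (hq : q ∈ Ioc (0 : ℝ) 1) (hy : y ∈ Ioo (0 : ℝ) 1) :
    0 < 1 - q ^ 2 * y ^ 2 := by
  have : q * y < 1 := by nlinarith [hy.1, hy.2, hq.1, hq.2]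
  have : 0 < q * y := mul_pos hq.1 hy.1
  nlinarith

theorem hasDerivAt_g {q y : ℝ} (hq : q ∈ Ioc (0 : ℝ) 1) (hy : y ∈ Ioo (0 : ℝ) 1) :
    HasDerivAt (g q) (-2 * y ^ 2 / √(1 - q ^ 2 * y ^ 2)) y := by
  have hp := one_sub_sq_mul_sq_pos hq hy
  have hs := Real.sqrt_pos.2 hp
  have hq0 := hq.1
  have hlin : HasDerivAt (fun y : ℝ => q * y) q y := by
    simpa using (hasDerivAt_id y).const_mul q
  have h2 := ((hasStrictDerivAt_f (x := q * y) (by rw [mul_pow]; linarith)).hasDerivAt.comp y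
    hlin).sub_const (f q)
  refine (h2.div_const (q ^ 3)).congr_deriv ?_
  rw [mul_pow]
  generalize √(1 - q ^ 2 * y ^ 2) = A at *
  field_simp

theorem continuous_g (q : ℝ) : Continuous (g q) := by
  have := continuous_f
  unfold g
  fun_prop

theorem g_one (q : ℝ) : g q 1 = 0 := by simp [g]

theorem g_pos {q y : ℝ} (hq : q ∈ Ioc (0 : ℝ) 1) (hy : y ∈ Ico (0 : ℝ) 1) : 0 < g q y := by
  rw [← g_one q]
  refine strictAntiOn_of_deriv_neg (convex_Icc 0 1) (continuous_g q).continuousOn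
    (fun z hz => ?_) ⟨hy.1, hy.2.le⟩ ⟨zero_le_one, le_rfl⟩ hy.2
  rw [interior_Icc] at hz
  rw [(hasDerivAt_g hq hz).deriv]
  have := Real.sqrt_pos.2 (one_sub_sq_mul_sq_pos hq hz)
  have := hz.1
  rw [neg_mul, neg_div, neg_lt_zero]
  positivity

/-- The coefficient 3/2 of `g` is the one that cancels the term 3y²/√(1 − q²y²) and leaves a
derivative of one sign. -/
theorem hasDerivAt_h {q y : ℝ} (hq : q ∈ Ioc (0 : ℝ) 1) (hy : y ∈ Ioo (0 : ℝ) 1) :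
    HasDerivAt (h q) (-(q ^ 2 * y ^ 4 / √(1 - q ^ 2 * y ^ 2) ^ 3)) y := by
  have hp := one_sub_sq_mul_sq_pos hq hy
  have hs := Real.sqrt_pos.2 hp
  have h1 : HasDerivAt (fun y : ℝ => 1 - q ^ 2 * y ^ 2) (-(q ^ 2 * (2 * y))) y := by
    simpa using ((hasDerivAt_pow 2 y).const_mul (q ^ 2)).const_sub 1
  have h2 := (((hasDerivAt_pow 3 y).div (h1.sqrt hp.ne') hs.ne').const_sub
    (1 / √(1 - q ^ 2))).sub ((hasDerivAt_g hq hy).const_mul (3 / 2))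
  refine h2.congr_deriv ?_
  have h3 := Real.sq_sqrt hp.le
  generalize √(1 - q ^ 2 * y ^ 2) = A at *
  field_simp
  push_cast
  ring_nf

/-- `h` decreases strictly to h(q, 1) = 0. The value q = 1 is excluded because continuity up to y =
1 would fail. -/
theorem h_pos {q y : ℝ} (hq : q ∈ Ioo (0 : ℝ) 1) (hy : y ∈ Ico (0 : ℝ) 1) : 0 < h q y := by
  have hq' : q ∈ Ioc (0 : ℝ) 1 := ⟨hq.1, hq.2.le⟩
  have h1 : h q 1 = 0 := by simp [h, g_one]
  rw [← h1]
  refine strictAntiOn_of_deriv_neg (convex_Icc 0 1) ?_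
    (fun z hz => ?_) ⟨hy.1, hy.2.le⟩ ⟨zero_le_one, le_rfl⟩ hy.2
  · have := continuous_g q
    unfold h
    refine (continuousOn_const.sub (ContinuousOn.div (by fun_prop) (by fun_prop) fun z hz => ?_)).sub
      (by fun_prop)
    refine (Real.sqrt_pos.2 ?_).ne'
    have h2 : q ^ 2 < 1 := by nlinarith [hq.1, hq.2]
    have h3 : z ^ 2 ≤ 1 := by nlinarith [hz.1, hz.2]
    nlinarith [sq_nonneg z, sq_nonneg q]
  · rw [interior_Icc] at hz
    rw [(hasDerivAt_h hq' hz).deriv, neg_lt_zero]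
    have := Real.sqrt_pos.2 (one_sub_sq_mul_sq_pos hq' hz)
    have := hz.1
    have := hq.1
    positivity

/-- Each term is nonnegative by the sign of q' or c'. This is what rules out shell crossings. -/
theorem Admissible.Λ_nonneg (hD : D.Admissible) {R y : ℝ} (hR : 0 < R) (hy : y ∈ Ico (0 : ℝ) 1) :
    0 ≤ D.Λ y R := by
  obtain ⟨hq, -⟩ := hD.q_mem hR
  have hg := g_pos hq hy
  have hc := hD.c_pos hR
  have hc' := hD.c_mono R hR
  have hq' := hD.q_mono R hR
  have h2 : 0 ≤ -(deriv D.c R / (2 * R * D.c R) * g (D.q R) y) := by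
    rw [← neg_mul, ← neg_div]
    have : 0 ≤ -deriv D.c R := by linarith
    positivity
  have h1 : 0 ≤ 2 * (deriv D.q R / (R * D.q R)) * h (D.q R) y := by
    have := hq.1
    rcases hq.2.lt_or_eq with hlt | heq
    · have := h_pos ⟨hq.1, hlt⟩ hy
      positivity
    -- `h_pos` does not cover q = 1, but there p = 0 and hence q' = −p p'/q = 0.
    · have hp : D.p R = 0 := by
        have := hD.sqrt_one_sub_q_sq hR
        rw [heq] at this
        simpa using this.symm
      rw [(hD.hasDerivAt_q hR).deriv]
      simp [q', hp]
  unfold Λ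
  linarith

/-- The derivative of `Λ` in `y`. -/
def Λy (D : DustData) (y R : ℝ) : ℝ :=
  y ^ 2 / √(1 - D.q R ^ 2 * y ^ 2) * (D.c' R / R / D.c R
    - 2 / D.q R * (D.q' R / R) * (D.q R ^ 2 * y ^ 2 / √(1 - D.q R ^ 2 * y ^ 2) ^ 2))

theorem Admissible.hasDerivAt_Λ (hD : D.Admissible) {R y : ℝ} (hR : 0 < R)
    (hy : y ∈ Ioo (0 : ℝ) 1) : HasDerivAt (fun y => D.Λ y R) (D.Λy y R) y := by
  obtain ⟨hq, -⟩ := hD.q_mem hR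
  have hd := ((hasDerivAt_h hq hy).const_mul (2 * (deriv D.q R / (R * D.q R)))).sub
    ((hasDerivAt_g hq hy).const_mul (deriv D.c R / (2 * R * D.c R)))
  refine hd.congr_deriv ?_
  rw [(hD.hasDerivAt_q hR).deriv, (hD.hasDerivAt_c hR).deriv]
  have := Real.sqrt_pos.2 (one_sub_sq_mul_sq_pos hq hy)
  have := hq.1
  have := hD.c_pos hR
  unfold Λy
  generalize √(1 - D.q R ^ 2 * y ^ 2) = A at *
  field_simp
  ring

theorem Admissible.p₀_nonneg (hD : D.Admissible) : 0 ≤ D.p₀ := by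
  refine ge_of_tendsto hD.tendsto_p ?_
  filter_upwards [self_mem_nhdsWithin] with R hR using hD.p_nonneg hR

theorem Admissible.q₀_sq (hD : D.Admissible) : D.q₀ ^ 2 = 1 - D.p₀ ^ 2 := by
  have h := Real.sqrt_pos.1 hD.q₀_pos
  exact Real.sq_sqrt h.le

theorem Admissible.tendsto_sqrt_one_sub (hD : D.Admissible) {l : Filter ℝ} {y R : ℝ → ℝ}
    (hy : Tendsto y l (𝓝 0)) (hR : Tendsto R l (𝓝[>] 0)) :
    Tendsto (fun s => √(1 - D.q (R s) ^ 2 * y s ^ 2)) l (𝓝 1) := by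
  simpa using ((((hD.tendsto_q.comp hR).pow 2).mul (hy.pow 2)).const_sub 1).sqrt

/-- `Λ` has a positive limit at the centre. -/
theorem Admissible.exists_tendsto_Λ (hD : D.Admissible) : ∃ L > 0, ∀ {l : Filter ℝ} {y R : ℝ → ℝ},
    Tendsto y l (𝓝 0) → Tendsto R l (𝓝[>] 0) →
      Tendsto (fun s => D.Λ (y s) (R s)) l (𝓝 L) := by
  obtain ⟨P, hP⟩ := hD.tendsto_p'_div
  obtain ⟨C, hC⟩ := hD.tendsto_c'_div
  have hQ := hD.tendsto_q'_div hP
  set Q := -(D.p₀ * P / D.q₀) with hQdef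
  have hq₀ := hD.q₀_pos
  have hc₀ := hD.c₀_pos
  have hp₀ := hD.p₀_nonneg
  have hsq := hD.q₀_sq
  have hq₀1 : D.q₀ ≤ 1 := by nlinarith [sq_nonneg D.p₀]
  have hg := g_pos ⟨hq₀, hq₀1⟩ (y := 0) ⟨le_rfl, one_pos⟩
  -- The witness is `Λ_eq` with y = 0 and p'/R, q'/R, c'/R, q, c replaced by their central limits.
  refine ⟨2 / D.q₀ * (-(P / D.q₀) - Q * (3 / 2 * g D.q₀ 0)) - C / (2 * D.c₀) * g D.q₀ 0,
    ?_, fun {l y R} hy hR => ?_⟩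
  · have hC0 : C ≤ 0 := by
      refine le_of_tendsto hC ?_
      filter_upwards [self_mem_nhdsWithin] with R hR
      exact div_nonpos_of_nonpos_of_nonneg (hD.c'_nonpos hR) (le_of_lt hR)
    have hQ0 : 0 ≤ Q := by
      refine ge_of_tendsto hQ ?_
      filter_upwards [self_mem_nhdsWithin] with R hR
      exact div_nonneg (hD.q'_nonneg hR) (le_of_lt hR)
    have hX : 0 ≤ -(P / D.q₀) - Q * (3 / 2 * g D.q₀ 0) ∧
        (0 < Q → 0 < -(P / D.q₀) - Q * (3 / 2 * g D.q₀ 0)) := by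
      rcases hp₀.eq_or_lt with hp | hp
      · have hQz : Q = 0 := by rw [hQdef, ← hp]; simp
        refine ⟨?_, fun h => absurd hQz h.ne'⟩
        -- Since q' = −p p'/q ≥ 0, p' ≤ 0 where p > 0, and p' = 0 where p = 0.
        have hPn : P ≤ 0 := by
          have hq0 : D.q₀ = 1 := by nlinarith
          refine le_of_tendsto hP ?_
          filter_upwards [self_mem_nhdsWithin] with R (hR : 0 < R)
          refine div_nonpos_of_nonpos_of_nonneg ?_ hR.le
          have h1 := hD.q'_nonneg hR
          have hpos := hD.p_nonneg hR
          rcases hpos.eq_or_lt with h0 | h0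
          · rw [hD.p'_eq_zero hR h0.symm]
          · unfold q' at h1
            by_contra hlt
            push Not at hlt
            have := div_pos (mul_pos h0 hlt) (hD.q_mem hR).1.1
            linarith
        have : P / D.q₀ ≤ 0 := div_nonpos_of_nonpos_of_nonneg hPn hq₀.le
        rw [hQz]
        linarith
      · have hlt : D.q₀ < 1 := by nlinarith
        have hh := h_pos ⟨hq₀, hlt⟩ (y := 0) ⟨le_rfl, one_pos⟩
        have hs : √(1 - D.q₀ ^ 2) = D.p₀ := by
          rw [hsq, sub_sub_cancel, Real.sqrt_sq hp₀]
        -- For p₀ > 0 one may divide by it: −P/q₀ = Q/p₀, which restores the original form of Λ and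
        -- brings in the sign of `h`.
        have heq : -(P / D.q₀) - Q * (3 / 2 * g D.q₀ 0) = Q * h D.q₀ 0 := by
          unfold h
          rw [hs, hQdef]
          field_simp
          ring
        rw [heq]
        exact ⟨by positivity, fun h => by positivity⟩
    have hY : 0 ≤ -(C / (2 * D.c₀) * g D.q₀ 0) ∧
        (C < 0 → 0 < -(C / (2 * D.c₀) * g D.q₀ 0)) := by
      rw [← neg_mul, ← neg_div]
      refine ⟨?_, fun h => ?_⟩
      · have : 0 ≤ -C := by linarith
        positivity
      · have : 0 < -C := by linarith
        positivity
    have hk : 0 < 2 / D.q₀ := by positivity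
    -- Nondegeneracy gives C < 0 or Q > 0, so one of the two nonnegative terms is strictly positive.
    rcases hD.nondegenerate with ⟨κ, hκ, hev⟩ | ⟨κ, hκ, hev⟩
    · have : C ≤ -κ := by
        refine le_of_tendsto hC ?_
        filter_upwards [hev, self_mem_nhdsWithin] with R h hR
        rwa [(hD.hasDerivAt_c hR).deriv] at h
      have h1 := hY.2 (by linarith)
      have h2 := mul_nonneg hk.le hX.1
      linarith
    · have : κ ≤ Q := by
        refine ge_of_tendsto hQ ?_
        filter_upwards [hev, self_mem_nhdsWithin] with R h hR
        rwa [(hD.hasDerivAt_q hR).deriv] at h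
      have h1 := mul_pos hk (hX.2 (by linarith))
      have h2 := hY.1
      linarith
  · have hq := hD.tendsto_q.comp hR
    have hc := hD.tendsto_c.comp hR
    have hS := hD.tendsto_sqrt_one_sub hy hR
    have hyS : Tendsto (fun s => y s ^ 3 / √(1 - D.q (R s) ^ 2 * y s ^ 2)) l (𝓝 0) := by
      simpa [Pi.div_def] using (hy.pow 3).div hS one_ne_zero
    have hgt : Tendsto (fun s => g (D.q (R s)) (y s)) l (𝓝 (g D.q₀ 0)) := by
      unfold g
      exact (((continuous_f.tendsto _).comp (hq.mul hy)).sub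
        ((continuous_f.tendsto _).comp hq)).div (hq.pow 3) (by positivity)
    have hlim := (((tendsto_const_nhds (x := (2 : ℝ))).div hq hq₀.ne').mul ((((hP.comp hR).div hq hq₀.ne').neg).sub
      ((hQ.comp hR).mul (hyS.add (hgt.const_mul (3 / 2)))))).sub
      (((hC.comp hR).div (hc.const_mul 2) (by positivity)).mul hgt)
    rw [zero_add] at hlim
    refine hlim.congr' ?_
    filter_upwards [hR.eventually self_mem_nhdsWithin] with s hs
    rw [hD.Λ_eq hs]
    rfl

/-- The factor y² in `Λy` survives the division by y as one power of y, times a convergent bracket.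
Hence this term of `radialSlopeY` is negligible at the centre. -/
theorem Admissible.tendsto_Λy (hD : D.Admissible) {l : Filter ℝ} {y R : ℝ → ℝ}
    (hy : Tendsto y l (𝓝 0)) (hR : Tendsto R l (𝓝[>] 0)) :
    Tendsto (fun s => D.Λy (y s) (R s) * √(1 - D.q (R s) ^ 2 * y s ^ 2) / y s) l (𝓝 0) := by
  obtain ⟨P, hP⟩ := hD.tendsto_p'_div
  obtain ⟨C, hC⟩ := hD.tendsto_c'_div
  have hQ := hD.tendsto_q'_div hP
  have hq := hD.tendsto_q.comp hR
  have hS := hD.tendsto_sqrt_one_sub hy hR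
  have hlim := hy.mul (((hC.comp hR).div (hD.tendsto_c.comp hR) hD.c₀_pos.ne').sub
    ((((tendsto_const_nhds (x := (2 : ℝ))).div hq hD.q₀_pos.ne').mul (hQ.comp hR)).mul
      (((hq.pow 2).mul (hy.pow 2)).div (hS.pow 2) (by norm_num))))
  rw [zero_mul] at hlim
  refine hlim.congr' ?_
  filter_upwards [hS.eventually_ne one_ne_zero] with s hs
  simp only [Function.comp_apply, Pi.div_apply]
  unfold Λy
  generalize √(1 - D.q (R s) ^ 2 * y s ^ 2) = A at *
  by_cases h0 : y s = 0
  · simp [h0]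
  · field_simp

theorem Admissible.continuousAt_Λ (hD : D.Admissible) {y R : ℝ} (hR : 0 < R)
    (hy : y ∈ Ioo (0 : ℝ) 1) : ContinuousAt (fun z : ℝ × ℝ => D.Λ z.1 z.2) (y, R) := by
  obtain ⟨hq, -⟩ := hD.q_mem hR
  have hq0 := hq.1
  have hc0 := hD.c_pos hR
  have hS := Real.sqrt_pos.2 (one_sub_sq_mul_sq_pos hq hy)
  have h2 : ContinuousAt (fun z : ℝ × ℝ => z.2) (y, R) := continuousAt_snd
  have h1 : ContinuousAt (fun z : ℝ × ℝ => z.1) (y, R) := continuousAt_fst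
  have hqc : ContinuousAt (fun z : ℝ × ℝ => D.q z.2) (y, R) :=
    (hD.hasDerivAt_q hR).continuousAt.comp' h2
  have hcc : ContinuousAt (fun z : ℝ × ℝ => D.c z.2) (y, R) :=
    (hD.hasDerivAt_c hR).continuousAt.comp' h2
  have hp' : ContinuousAt (fun z : ℝ × ℝ => D.p' z.2) (y, R) :=
    (hD.continuousAt_p' hR).comp' h2
  have hq' : ContinuousAt (fun z : ℝ × ℝ => D.q' z.2) (y, R) :=
    (hD.continuousAt_q' hR).comp' h2
  have hc' : ContinuousAt (fun z : ℝ × ℝ => D.c' z.2) (y, R) :=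
    (hD.continuousAt_c' hR).comp' h2
  have hg : ContinuousAt (fun z : ℝ × ℝ => g (D.q z.2) z.1) (y, R) := by
    have := continuous_f
    unfold g
    exact ContinuousAt.div (by fun_prop) (by fun_prop) (by positivity)
  -- The form of `Λ_eq` contains no 1/√(1 − q²), so it is continuous also at radii where q = 1.
  have hev : (fun z : ℝ × ℝ => D.Λ z.1 z.2) =ᶠ[𝓝 (y, R)] fun z =>
      2 / D.q z.2 * (-(D.p' z.2 / z.2 / D.q z.2) - D.q' z.2 / z.2 *
        (z.1 ^ 3 / √(1 - D.q z.2 ^ 2 * z.1 ^ 2) + 3 / 2 * g (D.q z.2) z.1))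
        - D.c' z.2 / z.2 / (2 * D.c z.2) * g (D.q z.2) z.1 := by
    filter_upwards [h2.eventually (lt_mem_nhds hR)] with z hz using hD.Λ_eq hz z.1
  refine ContinuousAt.congr ?_ hev.symm
  have h0 := hR.ne'
  have h3 := hS.ne'
  have h4 := hq0.ne'
  fun_prop (disch := first | assumption | positivity)

theorem Admissible.continuousAt_Λy (hD : D.Admissible) {y R : ℝ} (hR : 0 < R)
    (hy : y ∈ Ioo (0 : ℝ) 1) : ContinuousAt (fun z : ℝ × ℝ => D.Λy z.1 z.2) (y, R) := by
  obtain ⟨hq, -⟩ := hD.q_mem hR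
  have hq0 := hq.1
  have hc0 := hD.c_pos hR
  have hS := Real.sqrt_pos.2 (one_sub_sq_mul_sq_pos hq hy)
  have h2 : ContinuousAt (fun z : ℝ × ℝ => z.2) (y, R) := continuousAt_snd
  have hqc : ContinuousAt (fun z : ℝ × ℝ => D.q z.2) (y, R) :=
    (hD.hasDerivAt_q hR).continuousAt.comp' h2
  have hcc : ContinuousAt (fun z : ℝ × ℝ => D.c z.2) (y, R) :=
    (hD.hasDerivAt_c hR).continuousAt.comp' h2
  have hq' : ContinuousAt (fun z : ℝ × ℝ => D.q' z.2) (y, R) :=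
    (hD.continuousAt_q' hR).comp' h2
  have hc' : ContinuousAt (fun z : ℝ × ℝ => D.c' z.2) (y, R) :=
    (hD.continuousAt_c' hR).comp' h2
  have h0 := hR.ne'
  have h3 := hS.ne'
  have h4 := hq0.ne'
  have h5 := hc0.ne'
  unfold Λy
  fun_prop (disch := first | assumption | positivity)

/-! ### The scale `Y = √(r / R)` of a shell -/

/-- The solution `y ∈ (0, 1]` of `fallTime R y = τ`. -/
def Y (D : DustData) (τ R : ℝ) : ℝ := Function.invFunOn (D.fallTime R) (Ioc 0 1) τ

theorem arealRadius_eq (D : DustData) (τ R : ℝ) : D.arealRadius τ R = R * D.Y τ R ^ 2 := rfl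

theorem Admissible.Y_fallTime (hD : D.Admissible) {R y : ℝ} (hR : 0 < R) (hy : y ∈ Ioc (0 : ℝ) 1) :
    D.Y (D.fallTime R y) R = y := by
  have hinj := ((strictAntiOn_fallTime hD hR).1.injOn).mono Ioc_subset_Icc_self
  have hmem : ∃ z ∈ Ioc (0 : ℝ) 1, D.fallTime R z = D.fallTime R y := ⟨y, hy, rfl⟩
  exact hinj (Function.invFunOn_mem hmem) hy (Function.invFunOn_eq hmem)

theorem Admissible.Y_spec (hD : D.Admissible) {τ R : ℝ} (hR : 0 < R) (hτ : 0 < τ)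
    (hτ' : τ < D.singularTime R) : D.Y τ R ∈ Ioo (0 : ℝ) 1 ∧ D.fallTime R (D.Y τ R) = τ := by
  obtain ⟨-, hcont⟩ := strictAntiOn_fallTime hD hR
  obtain ⟨y, hy, rfl⟩ : τ ∈ D.fallTime R '' Ioo 0 1 :=
    intermediate_value_Ioo' zero_le_one hcont ⟨by rwa [fallTime_one], hτ'⟩
  rw [hD.Y_fallTime hR ⟨hy.1, hy.2.le⟩]
  exact ⟨hy, rfl⟩

attribute [irreducible] Y

/-- Near a regular point, `Y` is given by a local inverse of `f`. -/
theorem Admissible.exists_local_Y (hD : D.Admissible) {R y : ℝ} (hR : 0 < R)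
    (hy : y ∈ Ioo (0 : ℝ) 1) :
    ∃ L : ℝ → ℝ,
      HasDerivAt L (-2 * (D.q R * y) ^ 2 / √(1 - D.q R ^ 2 * y ^ 2))⁻¹ (f (D.q R * y)) ∧
      L (f (D.q R * y)) = D.q R * y ∧
      f (D.q R) + D.fallTime R y * (D.q R ^ 3 * √(D.c R)) = f (D.q R * y) ∧
      ∀ᶠ z in 𝓝 (D.fallTime R y, R), z.2 > 0 ∧ D.Y z.1 z.2 ∈ Ioo (0 : ℝ) 1 ∧
        D.fallTime z.2 (D.Y z.1 z.2) = z.1 ∧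
        D.Y z.1 z.2 = L (f (D.q z.2) + z.1 * (D.q z.2 ^ 3 * √(D.c z.2))) / D.q z.2 := by
  obtain ⟨hq, -⟩ := hD.q_mem hR
  have hq0 := hq.1
  have hy0 := hy.1
  have hc0 := hD.c_pos hR
  have hcs := Real.sqrt_pos.2 hc0
  have hp := one_sub_sq_mul_sq_pos hq hy
  have hS := Real.sqrt_pos.2 hp
  have hd := hasStrictDerivAt_f (x := D.q R * y) (by rw [mul_pow]; linarith)
  rw [mul_pow] at hd
  have hne : -2 * (D.q R ^ 2 * y ^ 2) / √(1 - D.q R ^ 2 * y ^ 2) ≠ 0 := by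
    have : 0 < 2 * (D.q R ^ 2 * y ^ 2) / √(1 - D.q R ^ 2 * y ^ 2) := by positivity
    rw [neg_mul, neg_div]
    linarith
  -- The equation `fallTime R y = τ` solved for f(q y). A local inverse of the one-variable `f` thus
  -- gives `Y` as a function of τ and R jointly.
  have hG0 : f (D.q R) + D.fallTime R y * (D.q R ^ 3 * √(D.c R)) = f (D.q R * y) := by
    unfold fallTime g
    field_simp
    ring
  have hL := hd.to_localInverse hne
  have hLz : hd.localInverse f _ _ hne (f (D.q R * y)) = D.q R * y :=
    HasStrictFDerivAt.localInverse_apply_image _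
  have hri : ∀ᶠ t in 𝓝 (f (D.q R * y)), f (hd.localInverse f _ _ hne t) = t :=
    HasStrictFDerivAt.eventually_right_inverse _
  generalize hd.localInverse f _ _ hne = L at *
  refine ⟨L, by rw [mul_pow]; exact hL.hasDerivAt, hLz, hG0, ?_⟩
  have h1 : ContinuousAt (fun z : ℝ × ℝ => z.1) (D.fallTime R y, R) := continuousAt_fst
  have h2 : ContinuousAt (fun z : ℝ × ℝ => z.2) (D.fallTime R y, R) := continuousAt_snd
  have hqc : ContinuousAt (fun z : ℝ × ℝ => D.q z.2) (D.fallTime R y, R) :=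
    (hD.hasDerivAt_q hR).continuousAt.comp' h2
  have hcc : ContinuousAt (fun z : ℝ × ℝ => D.c z.2) (D.fallTime R y, R) :=
    (hD.hasDerivAt_c hR).continuousAt.comp' h2
  have hGc : ContinuousAt (fun z : ℝ × ℝ => f (D.q z.2) + z.1 * (D.q z.2 ^ 3 * √(D.c z.2)))
      (D.fallTime R y, R) := by
    have := continuous_f
    fun_prop
  have hLc : ContinuousAt (fun z : ℝ × ℝ =>
      L (f (D.q z.2) + z.1 * (D.q z.2 ^ 3 * √(D.c z.2))) / D.q z.2) (D.fallTime R y, R) := by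
    refine ContinuousAt.div (ContinuousAt.comp' (g := L) ?_ hGc) hqc hq0.ne'
    simp only
    rw [hG0]
    exact hL.hasDerivAt.continuousAt
  have hval : L (f (D.q R) + D.fallTime R y * (D.q R ^ 3 * √(D.c R))) / D.q R = y := by
    rw [hG0, hLz]
    field_simp
  have e1 := hLc.eventually (p := fun u => u ∈ Ioo (0 : ℝ) 1)
    (by simp only; rw [hval]; exact Ioo_mem_nhds hy.1 hy.2)
  have e2 := hGc.eventually (p := fun u => f (L u) = u) (by simp only; rw [hG0]; exact hri)
  filter_upwards [e1, e2, h2.eventually (lt_mem_nhds hR)] with z hz1 hz2 hz3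
  have hqz := (hD.q_mem hz3).1.1
  have hcz := Real.sqrt_pos.2 (hD.c_pos hz3)
  set u := L (f (D.q z.2) + z.1 * (D.q z.2 ^ 3 * √(D.c z.2))) / D.q z.2 with hu
  have hft : D.fallTime z.2 u = z.1 := by
    unfold fallTime g
    rw [hu, mul_div_cancel₀ _ hqz.ne', hz2]
    field_simp
    ring
  -- By injectivity of the fall time on (0, 1], any solution there is the value of `Y`.
  have hYu : D.Y z.1 z.2 = u := by
    have := hD.Y_fallTime hz3 (y := u) ⟨hz1.1, hz1.2.le⟩
    rwa [hft] at this
  rw [hYu]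
  exact ⟨hz3, hz1, hft, rfl⟩

theorem Admissible.hasDerivAt_Y_time (hD : D.Admissible) {R y : ℝ} (hR : 0 < R)
    (hy : y ∈ Ioo (0 : ℝ) 1) :
    HasDerivAt (fun t => D.Y t R)
      (-(√(D.c R) * √(1 - D.q R ^ 2 * y ^ 2) / (2 * y ^ 2))) (D.fallTime R y) := by
  obtain ⟨L, hL, hLz, hG0, hev⟩ := hD.exists_local_Y hR hy
  have hq0 := (hD.q_mem hR).1.1
  have hy0 := hy.1
  have hS := Real.sqrt_pos.2 (one_sub_sq_mul_sq_pos (hD.q_mem hR).1 hy)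
  have hG : HasDerivAt (fun t => f (D.q R) + t * (D.q R ^ 3 * √(D.c R)))
      (D.q R ^ 3 * √(D.c R)) (D.fallTime R y) := by
    simpa using ((hasDerivAt_id (D.fallTime R y)).mul_const (D.q R ^ 3 * √(D.c R))).const_add
      (f (D.q R))
  rw [← hG0] at hL
  have h := (HasDerivAt.comp (D.fallTime R y) hL hG).div_const (D.q R)
  have hc : ContinuousAt (fun t : ℝ => (t, R)) (D.fallTime R y) := by fun_prop
  have heq : (fun t => D.Y t R) =ᶠ[𝓝 (D.fallTime R y)] fun t =>
      L (f (D.q R) + t * (D.q R ^ 3 * √(D.c R))) / D.q R := by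
    filter_upwards [hc.eventually hev] with t ht using ht.2.2.2
  refine (h.congr_of_eventuallyEq heq).congr_deriv ?_
  generalize √(1 - D.q R ^ 2 * y ^ 2) = A at *
  field_simp

/-- The origin of Λ: up to the prefactor, R Λ is what implicit differentiation of `fallTime R y = τ`
in R produces. -/
theorem Admissible.hasDerivAt_Y_radius (hD : D.Admissible) {R y : ℝ} (hR : 0 < R)
    (hy : y ∈ Ioo (0 : ℝ) 1) :
    HasDerivAt (fun x => D.Y (D.fallTime R y) x)
      (√(1 - D.q R ^ 2 * y ^ 2) / (2 * y ^ 2) * (R * D.Λ y R)) R := by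
  obtain ⟨L, hL, hLz, hG0, hev⟩ := hD.exists_local_Y hR hy
  have hq0 := (hD.q_mem hR).1.1
  have hy0 := hy.1
  have hc0 := hD.c_pos hR
  have hcs := Real.sqrt_pos.2 hc0
  have hS := Real.sqrt_pos.2 (one_sub_sq_mul_sq_pos (hD.q_mem hR).1 hy)
  have hqd := hD.hasDerivAt_q hR
  have hG := (hD.hasDerivAt_f_q hR).add
    (((hqd.pow 3).mul ((hD.hasDerivAt_c hR).sqrt hc0.ne')).const_mul (D.fallTime R y))
  have hL' := hL
  rw [← hG0] at hL'
  have h := (HasDerivAt.comp R hL' hG).div hqd hq0.ne'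
  have hc : ContinuousAt (fun x : ℝ => (D.fallTime R y, x)) R := by fun_prop
  have heq : (fun x => D.Y (D.fallTime R y) x) =ᶠ[𝓝 R] fun x =>
      L (f (D.q x) + D.fallTime R y * (D.q x ^ 3 * √(D.c x))) / D.q x := by
    filter_upwards [hc.eventually hev] with x hx using hx.2.2.2
  refine (h.congr_of_eventuallyEq heq).congr_deriv ?_
  simp only [Function.comp_apply, Pi.add_apply, Pi.mul_apply, Pi.pow_apply]
  rw [hG0, hLz, hD.Λ_eq hR]
  unfold fallTime
  have hs := Real.sq_sqrt hc0.le
  generalize √(1 - D.q R ^ 2 * y ^ 2) = A at *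
  generalize √(D.c R) = B at *
  rw [← hs]
  push_cast
  field_simp
  ring

/-- Regular points are interior, `Y` is continuous there and satisfies its defining equation. -/
theorem Admissible.eventually_Y (hD : D.Admissible) {τ R : ℝ} (hR : 0 < R) (hτ : 0 < τ)
    (hτ' : τ < D.singularTime R) :
    ∀ᶠ z in 𝓝 (τ, R), z.2 > 0 ∧ D.Y z.1 z.2 ∈ Ioo (0 : ℝ) 1 ∧
      D.fallTime z.2 (D.Y z.1 z.2) = z.1 := by
  obtain ⟨hy, hft⟩ := hD.Y_spec hR hτ hτ'
  obtain ⟨L, -, -, -, hev⟩ := hD.exists_local_Y hR hy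
  rw [hft] at hev
  filter_upwards [hev] with z hz using ⟨hz.1, hz.2.1, hz.2.2.1⟩

theorem Admissible.continuousAt_Y (hD : D.Admissible) {τ R : ℝ} (hR : 0 < R) (hτ : 0 < τ)
    (hτ' : τ < D.singularTime R) : ContinuousAt (fun z : ℝ × ℝ => D.Y z.1 z.2) (τ, R) := by
  obtain ⟨hy, hft⟩ := hD.Y_spec hR hτ hτ'
  obtain ⟨L, hL, -, hG0, hev⟩ := hD.exists_local_Y hR hy
  rw [hft] at hev hG0
  have hq0 := (hD.q_mem hR).1.1
  have h2 : ContinuousAt (fun z : ℝ × ℝ => z.2) (τ, R) := continuousAt_snd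
  have hqc : ContinuousAt (fun z : ℝ × ℝ => D.q z.2) (τ, R) :=
    (hD.hasDerivAt_q hR).continuousAt.comp' h2
  have hcc : ContinuousAt (fun z : ℝ × ℝ => D.c z.2) (τ, R) :=
    (hD.hasDerivAt_c hR).continuousAt.comp' h2
  have hGc : ContinuousAt (fun z : ℝ × ℝ => f (D.q z.2) + z.1 * (D.q z.2 ^ 3 * √(D.c z.2)))
      (τ, R) := by
    have := continuous_f
    fun_prop
  have hLc : ContinuousAt (fun z : ℝ × ℝ =>
      L (f (D.q z.2) + z.1 * (D.q z.2 ^ 3 * √(D.c z.2))) / D.q z.2) (τ, R) := by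
    refine ContinuousAt.div (ContinuousAt.comp' (g := L) ?_ hGc) hqc hq0.ne'
    simp only
    rw [hG0]
    exact hL.continuousAt
  refine hLc.congr ?_
  filter_upwards [hev] with z hz using hz.2.2.2.symm

/-! ### The metric coefficient `γ` -/

/-- `∂r/∂R` as a function of `y = √(r / R)` and `R`. -/
def radialSlope (D : DustData) (y R : ℝ) : ℝ :=
  y ^ 2 + R ^ 2 * D.Λ y R * (√(1 - D.q R ^ 2 * y ^ 2) / y)

/-- The derivative of `radialSlope` in `y`. -/
def radialSlopeY (D : DustData) (y R : ℝ) : ℝ :=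
  2 * y + R ^ 2 * (D.Λy y R * √(1 - D.q R ^ 2 * y ^ 2) / y
    - D.Λ y R / (√(1 - D.q R ^ 2 * y ^ 2) * y ^ 2))

/-- Absence of shell crossings: r' > 0 because Λ ≥ 0, so γ is finite and positive. -/
theorem Admissible.radialSlope_pos (hD : D.Admissible) {R y : ℝ} (hR : 0 < R)
    (hy : y ∈ Ioo (0 : ℝ) 1) : 0 < D.radialSlope y R := by
  have h1 := hD.Λ_nonneg hR ⟨hy.1.le, hy.2⟩
  have := hy.1
  unfold radialSlope
  positivity

theorem Admissible.hasDerivAt_radialSlope (hD : D.Admissible) {R y : ℝ} (hR : 0 < R)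
    (hy : y ∈ Ioo (0 : ℝ) 1) :
    HasDerivAt (fun y => D.radialSlope y R) (D.radialSlopeY y R) y := by
  have hy0 := hy.1
  have hp := one_sub_sq_mul_sq_pos (hD.q_mem hR).1 hy
  have hS := Real.sqrt_pos.2 hp
  have h1 : HasDerivAt (fun y : ℝ => 1 - D.q R ^ 2 * y ^ 2) (-(D.q R ^ 2 * (2 * y))) y := by
    simpa using ((hasDerivAt_pow 2 y).const_mul (D.q R ^ 2)).const_sub 1
  have h := (hasDerivAt_pow 2 y).add (((hD.hasDerivAt_Λ hR hy).const_mul (R ^ 2)).mul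
    ((h1.sqrt hp.ne').div (hasDerivAt_id y) hy0.ne'))
  refine h.congr_deriv ?_
  unfold radialSlopeY
  have hs := Real.sq_sqrt hp.le
  simp only [Pi.div_apply, id]
  generalize √(1 - D.q R ^ 2 * y ^ 2) = A at *
  push_cast
  field_simp
  -- With S = √(1 − q²y²), the derivative of S/y is −(q²y² + S²)/(S y²) = −1/(S y²).
  linear_combination (-R ^ 2 * D.Λ y R) * hs

theorem Admissible.hasDerivAt_arealRadius (hD : D.Admissible) {R y : ℝ} (hR : 0 < R)
    (hy : y ∈ Ioo (0 : ℝ) 1) :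
    HasDerivAt (fun x => D.arealRadius (D.fallTime R y) x) (D.radialSlope y R) R := by
  have h := (hasDerivAt_id R).mul ((hD.hasDerivAt_Y_radius hR hy).pow 2)
  have hY := hD.Y_fallTime hR ⟨hy.1, hy.2.le⟩
  have hy0 := hy.1
  simp only [arealRadius_eq]
  refine h.congr_deriv ?_
  simp only [id, Pi.pow_apply]
  rw [hY]
  unfold radialSlope
  push_cast
  field_simp

/-- 1 + 2E = v² + (1 − 2m/R), and the bracket is positive without trapped surfaces. -/
theorem Admissible.one_add_two_E_pos (hD : D.Admissible) {R : ℝ} (hR : 0 < R) :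
    0 < 1 + 2 * D.E R := by
  have := hD.untrapped R hR
  have h : 2 * D.m R / R = 2 * (D.m R / R) := by ring
  unfold E
  nlinarith [sq_nonneg (D.v R)]

theorem Admissible.γ_eq (hD : D.Admissible) {R y : ℝ} (hR : 0 < R) (hy : y ∈ Ioo (0 : ℝ) 1) :
    D.γ (D.fallTime R y) R = √(1 + 2 * D.E R) / D.radialSlope y R := by
  unfold γ
  rw [(hD.hasDerivAt_arealRadius hR hy).deriv]

theorem Admissible.γ_pos (hD : D.Admissible) {τ R : ℝ} (hR : 0 < R) (hτ : 0 < τ)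
    (hτ' : τ < D.singularTime R) : 0 < D.γ τ R := by
  obtain ⟨hy, hft⟩ := hD.Y_spec hR hτ hτ'
  rw [← hft, hD.γ_eq hR hy]
  exact div_pos (Real.sqrt_pos.2 (hD.one_add_two_E_pos hR)) (hD.radialSlope_pos hR hy)

/-- The value of `γ̇ / γ²` in terms of `y = √(r / R)` and `R`. -/
def ratioFormula (D : DustData) (y R : ℝ) : ℝ :=
  √(D.c R) * √(1 - D.q R ^ 2 * y ^ 2) / (2 * y ^ 2) * D.radialSlopeY y R / √(1 + 2 * D.E R)

/-- Only r' depends on τ, through y, so γ̇/γ² = −∂_τ r'/√(1 + 2E), and ∂_τ r' is `radialSlopeY`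
times ẏ. -/
theorem Admissible.hasDerivAt_γ (hD : D.Admissible) {τ R : ℝ} (hR : 0 < R) (hτ : 0 < τ)
    (hτ' : τ < D.singularTime R) :
    HasDerivAt (fun t => D.γ t R) (D.ratioFormula (D.Y τ R) R * D.γ τ R ^ 2) τ := by
  obtain ⟨hy, hft⟩ := hD.Y_spec hR hτ hτ'
  have hpos := hD.radialSlope_pos hR hy
  have hE := Real.sqrt_pos.2 (hD.one_add_two_E_pos hR)
  have hc : ContinuousAt (fun t : ℝ => (t, R)) τ := by fun_prop
  have heq : (fun t => D.γ t R) =ᶠ[𝓝 τ]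
      fun t => √(1 + 2 * D.E R) / D.radialSlope (D.Y t R) R := by
    filter_upwards [hc.eventually (hD.eventually_Y hR hτ hτ')] with t ht
    obtain ⟨-, h2, h3⟩ := ht
    conv_lhs => rw [← h3]
    exact hD.γ_eq hR h2
  have hY := hD.hasDerivAt_Y_time hR hy
  rw [hft] at hY
  have h := HasDerivAt.comp (h := fun t => D.Y t R) τ (hD.hasDerivAt_radialSlope hR hy) hY
  have h' := (hasDerivAt_const τ (√(1 + 2 * D.E R))).div h hpos.ne'
  refine (h'.congr_of_eventuallyEq heq).congr_deriv ?_
  rw [heq.eq_of_nhds]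
  simp only [Function.comp_apply]
  unfold ratioFormula
  field_simp
  ring

theorem Admissible.γdotRatio_eq (hD : D.Admissible) {τ R : ℝ} (hR : 0 < R) (hτ : 0 < τ)
    (hτ' : τ < D.singularTime R) : D.γdotRatio τ R = D.ratioFormula (D.Y τ R) R := by
  have := hD.γ_pos hR hτ hτ'
  unfold γdotRatio
  rw [(hD.hasDerivAt_γ hR hτ hτ').deriv]
  field_simp

theorem Admissible.deriv_Ψ (hD : D.Admissible) {τ R : ℝ} (hR : 0 < R) (hτ : 0 < τ)
    (hτ' : τ < D.singularTime R) :
    deriv (fun t => D.Ψ t R) τ = -(D.γdotRatio τ R * D.γ τ R) := by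
  have hpos := hD.γ_pos hR hτ hτ'
  have h := ((hD.hasDerivAt_γ hR hτ hτ').log hpos.ne').neg
  rw [hD.γdotRatio_eq hR hτ hτ']
  refine (h.congr_deriv ?_).deriv
  field_simp

theorem Admissible.exp_neg_two_Ψ (hD : D.Admissible) {τ R : ℝ} (hR : 0 < R) (hτ : 0 < τ)
    (hτ' : τ < D.singularTime R) : Real.exp (-2 * D.Ψ τ R) = D.γ τ R ^ 2 := by
  have hpos := hD.γ_pos hR hτ hτ'
  have : -2 * D.Ψ τ R = Real.log (D.γ τ R) + Real.log (D.γ τ R) := by unfold Ψ; ring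
  rw [this, Real.exp_add, Real.exp_log hpos, sq]

theorem Admissible.continuousAt_E (hD : D.Admissible) {R : ℝ} (hR : 0 < R) :
    ContinuousAt D.E R := by
  have h1 := (hD.hasDerivAt_m R).continuousAt
  have := hD.v_smooth.continuous
  unfold E
  exact ContinuousAt.sub (by fun_prop) (h1.div continuousAt_id hR.ne')

theorem Admissible.continuousAt_radialSlope (hD : D.Admissible) {y R : ℝ} (hR : 0 < R)
    (hy : y ∈ Ioo (0 : ℝ) 1) : ContinuousAt (fun z : ℝ × ℝ => D.radialSlope z.1 z.2) (y, R) := by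
  have hy0 := hy.1.ne'
  have h2 : ContinuousAt (fun z : ℝ × ℝ => z.2) (y, R) := continuousAt_snd
  have hqc : ContinuousAt (fun z : ℝ × ℝ => D.q z.2) (y, R) :=
    (hD.hasDerivAt_q hR).continuousAt.comp' h2
  have hΛ := hD.continuousAt_Λ hR hy
  unfold radialSlope
  fun_prop (disch := assumption)

theorem Admissible.continuousAt_ratioFormula (hD : D.Admissible) {y R : ℝ} (hR : 0 < R)
    (hy : y ∈ Ioo (0 : ℝ) 1) : ContinuousAt (fun z : ℝ × ℝ => D.ratioFormula z.1 z.2) (y, R) := by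
  have hy0 := hy.1.ne'
  have hS := (Real.sqrt_pos.2 (one_sub_sq_mul_sq_pos (hD.q_mem hR).1 hy)).ne'
  have hE0 := (Real.sqrt_pos.2 (hD.one_add_two_E_pos hR)).ne'
  have h2 : ContinuousAt (fun z : ℝ × ℝ => z.2) (y, R) := continuousAt_snd
  have hE : ContinuousAt (fun z : ℝ × ℝ => D.E z.2) (y, R) := (hD.continuousAt_E hR).comp' h2
  have hqc : ContinuousAt (fun z : ℝ × ℝ => D.q z.2) (y, R) :=
    (hD.hasDerivAt_q hR).continuousAt.comp' h2
  have hcc : ContinuousAt (fun z : ℝ × ℝ => D.c z.2) (y, R) :=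
    (hD.hasDerivAt_c hR).continuousAt.comp' h2
  have hΛ := hD.continuousAt_Λ hR hy
  have hΛy := hD.continuousAt_Λy hR hy
  have h3 : 2 * y ^ 2 ≠ 0 := by positivity
  have h4 : √(1 - D.q R ^ 2 * y ^ 2) * y ^ 2 ≠ 0 := by positivity
  unfold ratioFormula radialSlopeY
  fun_prop (disch := assumption)

theorem Admissible.continuousAt_Y_prodMk (hD : D.Admissible) {τ R : ℝ} (hR : 0 < R) (hτ : 0 < τ)
    (hτ' : τ < D.singularTime R) :
    ContinuousAt (fun z : ℝ × ℝ => (D.Y z.1 z.2, z.2)) (τ, R) :=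
  (hD.continuousAt_Y hR hτ hτ').prodMk continuousAt_snd

theorem Admissible.continuousAt_γ (hD : D.Admissible) {τ R : ℝ} (hR : 0 < R) (hτ : 0 < τ)
    (hτ' : τ < D.singularTime R) : ContinuousAt (fun z : ℝ × ℝ => D.γ z.1 z.2) (τ, R) := by
  obtain ⟨hy, -⟩ := hD.Y_spec hR hτ hτ'
  have hpos := (hD.radialSlope_pos hR hy).ne'
  have hE : ContinuousAt (fun z : ℝ × ℝ => D.E z.2) (τ, R) :=
    (hD.continuousAt_E hR).comp' continuousAt_snd
  have hs : ContinuousAt (fun z : ℝ × ℝ => D.radialSlope (D.Y z.1 z.2) z.2) (τ, R) :=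
    ContinuousAt.comp (f := fun z : ℝ × ℝ => (D.Y z.1 z.2, z.2))
      (hD.continuousAt_radialSlope hR hy) (hD.continuousAt_Y_prodMk hR hτ hτ')
  have hev : (fun z : ℝ × ℝ => √(1 + 2 * D.E z.2) / D.radialSlope (D.Y z.1 z.2) z.2)
      =ᶠ[𝓝 (τ, R)] fun z => D.γ z.1 z.2 := by
    filter_upwards [hD.eventually_Y hR hτ hτ'] with z hz
    conv_rhs => rw [← hz.2.2]
    exact (hD.γ_eq hz.1 hz.2.1).symm
  exact (((hE.const_mul 2).const_add 1).sqrt.div hs hpos).congr hev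

theorem Admissible.continuousAt_ratioFormula_Y (hD : D.Admissible) {τ R : ℝ} (hR : 0 < R)
    (hτ : 0 < τ) (hτ' : τ < D.singularTime R) :
    ContinuousAt (fun z : ℝ × ℝ => D.ratioFormula (D.Y z.1 z.2) z.2) (τ, R) :=
  ContinuousAt.comp (f := fun z : ℝ × ℝ => (D.Y z.1 z.2, z.2))
    (hD.continuousAt_ratioFormula hR (hD.Y_spec hR hτ hτ').1)
    (hD.continuousAt_Y_prodMk hR hτ hτ')

/-! ### Asymptotics along curves into the central singularity -/

theorem Admissible.tendsto_E (hD : D.Admissible) : Tendsto D.E (𝓝[>] 0) (𝓝 0) := by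
  have hv0 : D.v 0 = 0 := by
    have := hD.v_odd 0
    rw [neg_zero] at this
    linarith
  have hv : Tendsto (fun R => D.v R ^ 2 / 2) (𝓝[>] 0) (𝓝 (D.v 0 ^ 2 / 2)) :=
    (((hD.v_smooth.continuous.tendsto 0).pow 2).div_const 2).mono_left nhdsWithin_le_nhds
  have h := hv.sub (tendsto_div_of_hasDerivAt_zero (hD.hasDerivAt_m 0) (m_zero D))
  rw [hv0, zero_pow two_ne_zero] at h
  simpa using! h

theorem Admissible.χ_sq (hD : D.Admissible) {τ R : ℝ} (hR : 0 < R) :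
    D.χ τ R ^ 2 = D.c R * (R ^ 2 / D.Y τ R ^ 2) := by
  have hm := hD.m_pos hR
  unfold χ
  rw [arealRadius_eq, Real.sq_sqrt (by positivity)]
  unfold c
  -- At Y = 0 both sides are 0, by the value of division by zero.
  by_cases h : D.Y τ R = 0
  · simp [h]
  · field_simp

/-- The asymptotics of `γ̇ / γ²` along curves running into the central singularity with `χ → 1`. -/
theorem Admissible.tendsto_ratioFormula (hD : D.Admissible) {l : Filter ℝ} {y R : ℝ → ℝ} {L : ℝ}
    (hR : Tendsto R l (𝓝[>] 0)) (hy : Tendsto y l (𝓝 0))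
    (hχ : Tendsto (fun s => D.c (R s) * (R s ^ 2 / y s ^ 2)) l (𝓝 1))
    (hΛ : Tendsto (fun s => D.Λ (y s) (R s)) l (𝓝 L)) :
    Tendsto (fun s => R s ^ 2 * D.ratioFormula (y s) (R s)) l
      (𝓝 (-(L / (2 * D.c₀ ^ (3 / 2 : ℝ))))) := by
  have hc₀ := hD.c₀_pos
  have hcs := Real.sqrt_pos.2 hc₀
  have hc := hD.tendsto_c.comp hR
  have hS := hD.tendsto_sqrt_one_sub hy hR
  have hΛy := hD.tendsto_Λy hy hR
  have hE : Tendsto (fun s => √(1 + 2 * D.E (R s))) l (𝓝 1) := by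
    simpa using (((hD.tendsto_E.comp hR).const_mul 2).const_add 1).sqrt
  have hR0 : Tendsto R l (𝓝 0) := hR.mono_right nhdsWithin_le_nhds
  have hq : Tendsto (fun s => R s ^ 2 / y s ^ 2) l (𝓝 (1 / D.c₀)) := by
    refine (hχ.div hc hc₀.ne').congr' ?_
    filter_upwards [hR.eventually self_mem_nhdsWithin] with s hs
    have := hD.c_pos hs
    simp only [Pi.div_apply, Function.comp_apply]
    field_simp
  -- The factor R² is absorbed by 1/y², as R²/y² → 1/c₀. Inside `radialSlopeY` the terms 2y and
  -- R²·(Λ_y term) vanish; −Λ R²/y² → −L/c₀ survives.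
  have hlim := (((hc.sqrt.mul hS).div_const 2).mul hq).mul
    ((((hy.const_mul 2).add ((hR0.pow 2).mul hΛy)).sub
      ((hΛ.mul hq).div hS one_ne_zero)).div hE one_ne_zero)
  have hval : √D.c₀ * 1 / 2 * (1 / D.c₀) * ((2 * 0 + 0 ^ 2 * 0 - L * (1 / D.c₀) / 1) / 1)
      = -(L / (2 * D.c₀ ^ (3 / 2 : ℝ))) := by
    have h32 : D.c₀ ^ (3 / 2 : ℝ) = D.c₀ * √D.c₀ := by
      rw [Real.sqrt_eq_rpow, ← Real.rpow_one_add' hc₀.le (by norm_num)]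
      norm_num
    rw [h32]
    have hsq := Real.sq_sqrt hc₀.le
    generalize √D.c₀ = A at *
    rw [← hsq]
    field_simp
    ring
  rw [hval] at hlim
  refine hlim.congr' ?_
  filter_upwards with s
  simp only [Pi.div_apply, Function.comp_apply]
  unfold ratioFormula radialSlopeY
  ring

end DustData

namespace NullGeodesic

variable {D : DustData} (Γ : NullGeodesic D)

/-! ### Frequency along null geodesics -/

theorem ν_eq (s : ℝ) : Γ.ν s = Γ.πτ s := by
  simp [ν, DustData.metric, p]

theorem ν_pos {s : ℝ} (hs : s ∈ Ioo Γ.a Γ.b) : 0 < Γ.ν s := by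
  rw [ν_eq]
  exact Γ.πτ_pos s hs

theorem Y_spec (hD : D.Admissible) {s : ℝ} (hs : s ∈ Ioo Γ.a Γ.b) :
    D.Y (Γ.τ s) (Γ.R s) ∈ Ioo (0 : ℝ) 1 :=
  (hD.Y_spec (Γ.R_pos s hs) (Γ.τ_pos s hs) (Γ.τ_lt s hs)).1

theorem γ_pos (hD : D.Admissible) {s : ℝ} (hs : s ∈ Ioo Γ.a Γ.b) :
    0 < D.γ (Γ.τ s) (Γ.R s) :=
  hD.γ_pos (Γ.R_pos s hs) (Γ.τ_pos s hs) (Γ.τ_lt s hs)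

theorem r_pos (hD : D.Admissible) {s : ℝ} (hs : s ∈ Ioo Γ.a Γ.b) : 0 < Γ.r s := by
  have h1 := (Γ.Y_spec hD hs).1
  have h2 := Γ.R_pos s hs
  rw [r, DustData.arealRadius_eq]
  positivity

/-- The nullity constraint in terms of the frequency and the areal radius. -/
theorem πτ_sq (hD : D.Admissible) {s : ℝ} (hs : s ∈ Ioo Γ.a Γ.b) :
    Γ.πτ s ^ 2 = (D.γ (Γ.τ s) (Γ.R s) * Γ.πR s) ^ 2 + Γ.ℓ ^ 2 / Γ.r s ^ 2 := by
  have h := Γ.null s hs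
  have hγ := Γ.γ_pos hD hs
  have hr := Γ.r_pos hD hs
  rw [hD.exp_neg_two_Ψ (Γ.R_pos s hs) (Γ.τ_pos s hs) (Γ.τ_lt s hs)] at h
  simp only [DustData.metric, Matrix.cons_val, Real.sin_pi_div_two] at h
  change _ + Γ.r s ^ 2 * (_ + _ * (Γ.ℓ / Γ.r s ^ 2 * (Γ.ℓ / Γ.r s ^ 2))) = 0 at h
  field_simp at h ⊢
  linarith

/-- The nullity constraint divided by (π^τ)². It makes r ν √(1 − Π²) = |ℓ| constant along the ray,
which is the nonradial redshift formula. -/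
theorem one_sub_Pi_sq (hD : D.Admissible) {s : ℝ} (hs : s ∈ Ioo Γ.a Γ.b) :
    1 - Γ.Pi s ^ 2 = (Γ.ℓ / (Γ.r s * Γ.ν s)) ^ 2 := by
  have h := Γ.πτ_sq hD hs
  have hν := Γ.ν_pos hs
  have hr := Γ.r_pos hD hs
  rw [ν_eq] at *
  unfold Pi
  generalize D.γ (Γ.τ s) (Γ.R s) * Γ.πR s = A at *
  field_simp at h ⊢
  linarith

variable {Γ}

theorem EmanatesAtOneOne.tendsto_R (h : Γ.EmanatesAtOneOne) :
    Tendsto Γ.R (𝓝[>] Γ.a) (𝓝[>] 0) :=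
  tendsto_nhdsWithin_iff.2 ⟨h.R_tendsto,
    mem_of_superset (Ioo_mem_nhdsGT Γ.hab) fun s hs => Γ.R_pos s hs⟩

theorem EmanatesAtOneOne.tendsto_χ_sq (hD : D.Admissible) (h : Γ.EmanatesAtOneOne) :
    Tendsto (fun s => D.c (Γ.R s) * (Γ.R s ^ 2 / D.Y (Γ.τ s) (Γ.R s) ^ 2)) (𝓝[>] Γ.a) (𝓝 1) := by
  have h1 := h.χ_tendsto.pow 2
  rw [one_pow] at h1
  refine h1.congr' ?_
  filter_upwards [Ioo_mem_nhdsGT Γ.hab] with s hs using hD.χ_sq (Γ.R_pos s hs)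

/-- Y² = c R²/χ², where c and χ have finite positive limits and R → 0. -/
theorem EmanatesAtOneOne.tendsto_Y (hD : D.Admissible) (h : Γ.EmanatesAtOneOne) :
    Tendsto (fun s => D.Y (Γ.τ s) (Γ.R s)) (𝓝[>] Γ.a) (𝓝 0) := by
  have h1 := (((hD.tendsto_c.comp h.tendsto_R).mul (h.R_tendsto.pow 2)).div
    (h.tendsto_χ_sq hD) one_ne_zero).sqrt
  rw [zero_pow two_ne_zero, mul_zero, zero_div, Real.sqrt_zero] at h1
  refine h1.congr' ?_
  filter_upwards [Ioo_mem_nhdsGT Γ.hab] with s hs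
  have hR := Γ.R_pos s hs
  have hc := hD.c_pos hR
  have hy := (Γ.Y_spec hD hs).1
  rw [Real.sqrt_eq_iff_mul_self_eq_of_pos hy]
  simp only [Pi.div_apply, Function.comp_apply]
  field_simp

theorem EmanatesAtOneOne.tendsto_r (hD : D.Admissible) (h : Γ.EmanatesAtOneOne) :
    Tendsto Γ.r (𝓝[>] Γ.a) (𝓝 0) := by
  have h1 := h.R_tendsto.mul ((h.tendsto_Y hD).pow 2)
  rw [zero_mul] at h1
  exact h1.congr fun s => (DustData.arealRadius_eq D _ _).symm

variable (Γ) in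
/-- Redshift of a nonradial ray between two of its points. -/
theorem ν_div_ν_of_ℓ_ne_zero (hD : D.Admissible) (hℓ : Γ.ℓ ≠ 0) {s t : ℝ} (hs : s ∈ Ioo Γ.a Γ.b)
    (ht : t ∈ Ioo Γ.a Γ.b) :
    Γ.ν t / Γ.ν s = Γ.r s / Γ.r t * √((1 - Γ.Pi s ^ 2) / (1 - Γ.Pi t ^ 2)) := by
  have hνs := Γ.ν_pos hs
  have hνt := Γ.ν_pos ht
  have hrs := Γ.r_pos hD hs
  have hrt := Γ.r_pos hD ht
  rw [Γ.one_sub_Pi_sq hD hs, Γ.one_sub_Pi_sq hD ht, ← div_pow]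
  have : Γ.ℓ / (Γ.r s * Γ.ν s) / (Γ.ℓ / (Γ.r t * Γ.ν t)) = Γ.r t * Γ.ν t / (Γ.r s * Γ.ν s) := by
    field_simp
  rw [this, Real.sqrt_sq (by positivity)]
  field_simp

theorem EmanatesAtOneOne.tendsto_ν_div_of_ℓ_ne_zero (hD : D.Admissible) (h : Γ.EmanatesAtOneOne)
    (hℓ : Γ.ℓ ≠ 0) {t : ℝ} (ht : t ∈ Ioo Γ.a Γ.b) :
    Tendsto (fun s => Γ.ν t / Γ.ν s) (𝓝[>] Γ.a) (𝓝 0) := by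
  have h1 := ((h.tendsto_r hD).div_const (Γ.r t)).mul
    (((h.Pi_tendsto.pow 2).const_sub 1).div_const (1 - Γ.Pi t ^ 2)).sqrt
  rw [zero_div, zero_mul] at h1
  refine h1.congr' ?_
  filter_upwards [Ioo_mem_nhdsGT Γ.hab] with s hs using (Γ.ν_div_ν_of_ℓ_ne_zero hD hℓ hs ht).symm

/-! ### Radial rays -/

/-- A radial ray emanating with `Π → 1` is outgoing. -/
theorem EmanatesAtOneOne.γ_mul_πR (hD : D.Admissible) (h : Γ.EmanatesAtOneOne) (hℓ : Γ.ℓ = 0)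
    {s : ℝ} (hs : s ∈ Ioo Γ.a Γ.b) : D.γ (Γ.τ s) (Γ.R s) * Γ.πR s = Γ.πτ s := by
  have hsq : ∀ t ∈ Ioo Γ.a Γ.b, Γ.πτ t ^ 2 = (D.γ (Γ.τ t) (Γ.R t) * Γ.πR t) ^ 2 := by
    intro t ht
    simpa [hℓ] using Γ.πτ_sq hD ht
  -- Nullity leaves γπ^R = ±π^τ ≠ 0, so by continuity π^R keeps one sign; Π → 1 makes it positive
  -- near the start of the ray.
  have hne : ∀ t ∈ Ioo Γ.a Γ.b, Γ.πR t ≠ 0 := by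
    intro t ht h0
    have h1 := hsq t ht
    have h2 := Γ.πτ_pos t ht
    rw [h0] at h1
    nlinarith
  have hcont : ContinuousOn Γ.πR (Ioo Γ.a Γ.b) := fun t ht =>
    (Γ.πR_eq t ht).continuousAt.continuousWithinAt
  obtain ⟨t, ht1, ht⟩ := ((h.Pi_tendsto.eventually (lt_mem_nhds zero_lt_one)).and
    (Ioo_mem_nhdsGT Γ.hab)).exists
  have hpos : 0 < Γ.πR t := by
    by_contra hle
    push Not at hle
    have h1 := Γ.γ_pos hD ht
    have h2 := Γ.πτ_pos t ht
    have : Γ.Pi t ≤ 0 := div_nonpos_of_nonpos_of_nonneg (mul_nonpos_of_nonneg_of_nonpos h1.le hle)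
      h2.le
    linarith
  have hpos' : 0 < Γ.πR s := by
    by_contra hle
    push Not at hle
    obtain ⟨u, hu, hu0⟩ := isPreconnected_Ioo.intermediate_value hs ht hcont ⟨hle, hpos.le⟩
    exact hne u hu hu0
  exact ((sq_eq_sq₀ (Γ.πτ_pos s hs).le (mul_pos (Γ.γ_pos hD hs) hpos').le).1 (hsq s hs)).symm

theorem EmanatesAtOneOne.hasDerivAt_R (hD : D.Admissible) (h : Γ.EmanatesAtOneOne) (hℓ : Γ.ℓ = 0)
    {s : ℝ} (hs : s ∈ Ioo Γ.a Γ.b) :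
    HasDerivAt Γ.R (D.γ (Γ.τ s) (Γ.R s) * Γ.πτ s) s := by
  refine (Γ.R_eq s hs).congr_deriv ?_
  rw [hD.exp_neg_two_Ψ (Γ.R_pos s hs) (Γ.τ_pos s hs) (Γ.τ_lt s hs), ← h.γ_mul_πR hD hℓ hs]
  ring

/-- With ℓ = 0 and Ψ = −log γ the geodesic equation is dπ^τ/dλ = (γ̇/γ)(γπ^R)², and γπ^R = π^τ. The
factor γπ^τ is dR/dλ, so d log ν = (γ̇/γ²) dR. -/
theorem EmanatesAtOneOne.hasDerivAt_log_πτ (hD : D.Admissible) (h : Γ.EmanatesAtOneOne)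
    (hℓ : Γ.ℓ = 0) {s : ℝ} (hs : s ∈ Ioo Γ.a Γ.b) :
    HasDerivAt (fun s => Real.log (Γ.πτ s))
      (D.γdotRatio (Γ.τ s) (Γ.R s) * (D.γ (Γ.τ s) (Γ.R s) * Γ.πτ s)) s := by
  have hpos := Γ.πτ_pos s hs
  refine ((Γ.πτ_eq s hs).log hpos.ne').congr_deriv ?_
  rw [hD.exp_neg_two_Ψ (Γ.R_pos s hs) (Γ.τ_pos s hs) (Γ.τ_lt s hs),
    hD.deriv_Ψ (Γ.R_pos s hs) (Γ.τ_pos s hs) (Γ.τ_lt s hs), hℓ, div_eq_iff hpos.ne']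
  have := h.γ_mul_πR hD hℓ hs
  rw [← this]
  ring

theorem EmanatesAtOneOne.tendsto_γdotRatio (hD : D.Admissible) (h : Γ.EmanatesAtOneOne) {L : ℝ}
    (hΛ : Tendsto (fun s => D.Λ (D.Y (Γ.τ s) (Γ.R s)) (Γ.R s)) (𝓝[>] Γ.a) (𝓝 L)) :
    Tendsto (fun s => Γ.R s ^ 2 * D.γdotRatio (Γ.τ s) (Γ.R s)) (𝓝[>] Γ.a)
      (𝓝 (-(L / (2 * D.c₀ ^ (3 / 2 : ℝ))))) := by
  refine (hD.tendsto_ratioFormula h.tendsto_R (h.tendsto_Y hD) (h.tendsto_χ_sq hD) hΛ).congr' ?_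
  filter_upwards [Ioo_mem_nhdsGT Γ.hab] with s hs
  rw [hD.γdotRatio_eq (Γ.R_pos s hs) (Γ.τ_pos s hs) (Γ.τ_lt s hs)]

/-- The frequency of a radial ray diverges at the central singularity. -/
theorem EmanatesAtOneOne.tendsto_ν_atTop (hD : D.Admissible) (h : Γ.EmanatesAtOneOne)
    (hℓ : Γ.ℓ = 0) {A : ℝ} (hA : 0 < A)
    (hlim : Tendsto (fun s => Γ.R s ^ 2 * D.γdotRatio (Γ.τ s) (Γ.R s)) (𝓝[>] Γ.a) (𝓝 (-A))) :
    Tendsto Γ.ν (𝓝[>] Γ.a) atTop := by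
  -- Any constant in (0, A) would do in place of A/2: near the start d log ν/dR < −(A/2)/R², hence
  -- log ν − (A/2)/R decreases along the ray.
  have hev := (hlim.eventually (gt_mem_nhds (show -A < -(A / 2) by linarith))).and
    (Ioo_mem_nhdsGT Γ.hab)
  obtain ⟨u, hu, hsub⟩ := mem_nhdsGT_iff_exists_Ioo_subset.1 hev
  have hu : Γ.a < u := hu
  have hd : ∀ s ∈ Ioo Γ.a u, HasDerivAt (fun s => Real.log (Γ.πτ s) - A / 2 * (Γ.R s)⁻¹)
      (D.γdotRatio (Γ.τ s) (Γ.R s) * (D.γ (Γ.τ s) (Γ.R s) * Γ.πτ s) -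
        A / 2 * (-(D.γ (Γ.τ s) (Γ.R s) * Γ.πτ s) / Γ.R s ^ 2)) s := by
    intro s hs
    have hs' := (hsub hs).2
    exact (h.hasDerivAt_log_πτ hD hℓ hs').sub
      (((h.hasDerivAt_R hD hℓ hs').inv (Γ.R_pos s hs').ne').const_mul _)
  have hanti : AntitoneOn (fun s => Real.log (Γ.πτ s) - A / 2 * (Γ.R s)⁻¹) (Ioo Γ.a u) := by
    refine antitoneOn_of_deriv_nonpos (convex_Ioo _ _)
      (fun s hs => (hd s hs).continuousAt.continuousWithinAt) (fun s hs => ?_) (fun s hs => ?_)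
    · rw [interior_Ioo] at hs
      exact (hd s hs).differentiableAt.differentiableWithinAt
    · rw [interior_Ioo] at hs
      rw [(hd s hs).deriv]
      obtain ⟨h1, hs'⟩ := hsub hs
      have hR := Γ.R_pos s hs'
      have hk := mul_pos (Γ.γ_pos hD hs') (Γ.πτ_pos s hs')
      generalize D.γ (Γ.τ s) (Γ.R s) * Γ.πτ s = k at *
      have : D.γdotRatio (Γ.τ s) (Γ.R s) * k - A / 2 * (-k / Γ.R s ^ 2)
          = (Γ.R s ^ 2 * D.γdotRatio (Γ.τ s) (Γ.R s) + A / 2) * (k / Γ.R s ^ 2) := by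
        field_simp
        ring
      rw [this]
      exact mul_nonpos_of_nonpos_of_nonneg (by linarith) (by positivity)
  obtain ⟨t, ht⟩ := nonempty_Ioo.2 hu
  set C := Real.log (Γ.πτ t) - A / 2 * (Γ.R t)⁻¹ with hC
  have hlog : Tendsto (fun s => Real.log (Γ.πτ s)) (𝓝[>] Γ.a) atTop := by
    have h1 : Tendsto (fun s => C + A / 2 * (Γ.R s)⁻¹) (𝓝[>] Γ.a) atTop :=
      tendsto_atTop_add_const_left _ _
        ((tendsto_inv_nhdsGT_zero.comp h.tendsto_R).const_mul_atTop (by positivity))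
    -- Comparison with the fixed point t: log ν ≥ C + (A/2)/R, which diverges as R → 0.
    refine tendsto_atTop_mono' _ ?_ h1
    filter_upwards [Ioo_mem_nhdsGT ht.1] with s hs
    have := hanti ⟨hs.1, hs.2.trans ht.2⟩ ht hs.2.le
    simp only at this
    linarith
  refine (Real.tendsto_exp_atTop.comp hlog).congr' ?_
  filter_upwards [Ioo_mem_nhdsGT Γ.hab] with s hs
  rw [ν_eq]
  exact Real.exp_log (Γ.πτ_pos s hs)

/-- Redshift of a radial ray between two of its points. -/
theorem EmanatesAtOneOne.ν_div_ν_of_ℓ_eq_zero (hD : D.Admissible) (h : Γ.EmanatesAtOneOne)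
    (hℓ : Γ.ℓ = 0) {s t : ℝ} (hs : s ∈ Ioo Γ.a Γ.b) (ht : t ∈ Ioo Γ.a Γ.b) (hst : s ≤ t)
    {τplus : ℝ → ℝ} (hτ : ∀ u ∈ Icc s t, τplus (Γ.R u) = Γ.τ u) :
    IntervalIntegrable (fun R => D.γdotRatio (τplus R) R) MeasureTheory.volume (Γ.R s) (Γ.R t) ∧
      Γ.ν t / Γ.ν s = Real.exp (∫ R in (Γ.R s)..(Γ.R t), D.γdotRatio (τplus R) R) := by
  have hsub : ∀ u ∈ Icc s t, u ∈ Ioo Γ.a Γ.b := fun u hu =>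
    ⟨hs.1.trans_le hu.1, hu.2.trans_lt ht.2⟩
  have hRd : ∀ u ∈ Icc s t, HasDerivAt Γ.R (D.γ (Γ.τ u) (Γ.R u) * Γ.πτ u) u := fun u hu =>
    h.hasDerivAt_R hD hℓ (hsub u hu)
  have hRc : ContinuousOn Γ.R (uIcc s t) := by
    rw [uIcc_of_le hst]
    exact fun u hu => (hRd u hu).continuousAt.continuousWithinAt
  have hRd' : ∀ u ∈ Ioo (min s t) (max s t),
      HasDerivAt Γ.R (D.γ (Γ.τ u) (Γ.R u) * Γ.πτ u) u := by
    rw [min_eq_left hst, max_eq_right hst]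
    exact fun u hu => hRd u ⟨hu.1.le, hu.2.le⟩
  have hRpos : ∀ u ∈ Ioo (min s t) (max s t), 0 ≤ D.γ (Γ.τ u) (Γ.R u) * Γ.πτ u := by
    rw [min_eq_left hst, max_eq_right hst]
    intro u hu
    have hu' := hsub u ⟨hu.1.le, hu.2.le⟩
    exact (mul_pos (Γ.γ_pos hD hu') (Γ.πτ_pos u hu')).le
  -- `τplus` is prescribed only on the image of the ray, so continuity is shown for the integrand
  -- pulled back to the affine parameter, through `ratioFormula`.
  have hEq : EqOn
      (fun u => D.ratioFormula (D.Y (Γ.τ u) (Γ.R u)) (Γ.R u) * (D.γ (Γ.τ u) (Γ.R u) * Γ.πτ u))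
      (fun u => ((fun R => D.γdotRatio (τplus R) R) ∘ Γ.R) u *
        (D.γ (Γ.τ u) (Γ.R u) * Γ.πτ u)) (Icc s t) := by
    intro u hu
    have hu' := hsub u hu
    simp only [Function.comp_apply]
    rw [hτ u hu, hD.γdotRatio_eq (Γ.R_pos u hu') (Γ.τ_pos u hu') (Γ.τ_lt u hu')]
  have hcont : ContinuousOn (fun u => ((fun R => D.γdotRatio (τplus R) R) ∘ Γ.R) u *
        (D.γ (Γ.τ u) (Γ.R u) * Γ.πτ u)) (Icc s t) := by
    refine ContinuousOn.congr (fun u hu => ?_) hEq.symm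
    have hu' := hsub u hu
    have hcu : ContinuousAt (fun u => (Γ.τ u, Γ.R u)) u :=
      (Γ.τ_eq u hu').continuousAt.prodMk (hRd u hu).continuousAt
    have h1 := ContinuousAt.comp (f := fun u => (Γ.τ u, Γ.R u))
      (hD.continuousAt_ratioFormula_Y (Γ.R_pos u hu') (Γ.τ_pos u hu') (Γ.τ_lt u hu')) hcu
    have h2 := ContinuousAt.comp (f := fun u => (Γ.τ u, Γ.R u))
      (hD.continuousAt_γ (Γ.R_pos u hu') (Γ.τ_pos u hu') (Γ.τ_lt u hu')) hcu
    exact (h1.mul (h2.mul (Γ.πτ_eq u hu').continuousAt)).continuousWithinAt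
  have hint : IntervalIntegrable (fun u => ((fun R => D.γdotRatio (τplus R) R) ∘ Γ.R) u *
      (D.γ (Γ.τ u) (Γ.R u) * Γ.πτ u)) MeasureTheory.volume s t := by
    refine ContinuousOn.intervalIntegrable ?_
    rwa [uIcc_of_le hst]
  -- R is nondecreasing along the ray, so the change of variables carries integrability in the
  -- affine parameter over to R.
  refine ⟨(intervalIntegral.integrable_comp_mul_deriv_iff_of_deriv_nonneg hRc hRd' hRpos).1 hint,
    ?_⟩
  rw [← intervalIntegral.integral_comp_mul_deriv_of_deriv_nonneg hRc hRd' hRpos,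
    intervalIntegral.integral_eq_sub_of_hasDerivAt (f := fun u => Real.log (Γ.πτ u)) ?_ hint]
  · rw [Real.exp_sub, Real.exp_log (Γ.πτ_pos s hs), Real.exp_log (Γ.πτ_pos t ht), ν_eq, ν_eq]
  · rw [uIcc_of_le hst]
    intro u hu
    refine (h.hasDerivAt_log_πτ hD hℓ (hsub u hu)).congr_deriv ?_
    simp only [Function.comp_apply]
    rw [hτ u hu]

end NullGeodesic

end

/-! ### The main theorem -/

theorem mainTheorem3 (D : DustData) (hD : D.Admissible) :
    ∃ A₀ : ℝ, 0 < A₀ ∧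
      Tendsto (fun R => D.Λ 0 R / (2 * D.c R ^ (3 / 2 : ℝ))) (𝓝[>] 0) (𝓝 A₀) ∧
      ∀ Γ : NullGeodesic D, Γ.EmanatesAtOneOne →
        -- infinite redshift, for radial and nonradial rays
        (∀ s_obs ∈ Ioo Γ.a Γ.b,
          Tendsto (fun s_e => Γ.ν s_obs / Γ.ν s_e) (𝓝[>] Γ.a) (𝓝 0)) ∧
        -- nonradial rays
        (Γ.ℓ ≠ 0 →
          (∀ s ∈ Ioo Γ.a Γ.b, 0 < Γ.r s ∧ Γ.Pi s ^ 2 < 1) ∧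
          ∀ s_e ∈ Ioo Γ.a Γ.b, ∀ s_obs ∈ Ioo Γ.a Γ.b,
            Γ.ν s_obs / Γ.ν s_e =
              Γ.r s_e / Γ.r s_obs * √((1 - Γ.Pi s_e ^ 2) / (1 - Γ.Pi s_obs ^ 2))) ∧
        -- radial rays; `τplus` is the proper time along the ray as a function of `R`
        (Γ.ℓ = 0 →
          Tendsto (fun s => Γ.R s ^ 2 * D.γdotRatio (Γ.τ s) (Γ.R s)) (𝓝[>] Γ.a) (𝓝 (-A₀)) ∧
          ∀ s_e ∈ Ioo Γ.a Γ.b, ∀ s_obs ∈ Ioo Γ.a Γ.b, s_e ≤ s_obs →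
            ∀ τplus : ℝ → ℝ, (∀ s ∈ Icc s_e s_obs, τplus (Γ.R s) = Γ.τ s) →
              IntervalIntegrable (fun R => D.γdotRatio (τplus R) R) MeasureTheory.volume
                (Γ.R s_e) (Γ.R s_obs) ∧
              Γ.ν s_obs / Γ.ν s_e =
                Real.exp (∫ R in (Γ.R s_e)..(Γ.R s_obs), D.γdotRatio (τplus R) R)) := by
  obtain ⟨L, hL, hΛ⟩ := hD.exists_tendsto_Λ
  have hc₀ := hD.c₀_pos
  have hA : 0 < L / (2 * D.c₀ ^ (3 / 2 : ℝ)) := by positivity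
  refine ⟨L / (2 * D.c₀ ^ (3 / 2 : ℝ)), hA, ?_, fun Γ hΓ => ?_⟩
  -- The same limit L serves for y ≡ 0, which identifies A₀, and for y = `Y` along the ray, since
  -- `exists_tendsto_Λ` allows any y → 0.
  · exact (hΛ tendsto_const_nhds tendsto_id).div
      ((hD.tendsto_c.rpow_const (Or.inl hc₀.ne')).const_mul 2) (by positivity)
  have hlim := hΓ.tendsto_γdotRatio hD (hΛ (hΓ.tendsto_Y hD) hΓ.tendsto_R)
  refine ⟨fun t ht => ?_, fun hℓ => ⟨fun s hs => ⟨Γ.r_pos hD hs, ?_⟩, fun s hs t ht =>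
    Γ.ν_div_ν_of_ℓ_ne_zero hD hℓ hs ht⟩, fun hℓ => ⟨hlim, fun s hs t ht hst τplus hτ =>
    hΓ.ν_div_ν_of_ℓ_eq_zero hD hℓ hs ht hst hτ⟩⟩
  · by_cases hℓ : Γ.ℓ = 0
    · exact (hΓ.tendsto_ν_atTop hD hℓ hA hlim).const_div_atTop _
    · exact hΓ.tendsto_ν_div_of_ℓ_ne_zero hD hℓ ht
  · have h1 := Γ.one_sub_Pi_sq hD hs
    have h2 := Γ.r_pos hD hs
    have h3 := Γ.ν_pos hs
    have : 0 < (Γ.ℓ / (Γ.r s * Γ.ν s)) ^ 2 := by positivity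
    linarith
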